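/- Let $N\ge 1$ and $B\ge 0$ be integers with $N\ge 3B+1$. A message source consists of $K$ independent messages $W_1,\dots,W_K$, each uniform on the words of length $L\ge 1$ over a finite alphabet of size $q\ge 2$. A scheme consists of: a (randomized) distribution of the messages to the servers, giving storage $S_n$ to server $n\in[N]$; masking variables $(Z_n)_{n\in[N]}$; queries $(Q_n^{[\theta]})_{n\in[N]}$ of a user who wants message $\theta$, with $\theta$ uniform on $[K]$; answers $A_n^{[\theta]}$ of the honest servers, which are functions of $(S_n,Q_n^{[\theta]},Z_n)$; and a decoder applied to $\theta$, $Q^{[\theta]}_{[N]}$ and $A^{[\theta]}_{[N]}$. All these alphabets are finite, $(W_{[K]},S_{[N]})$, $Z_{[N]}$ and $(\theta,Q^{[\theta]}_{[N]})$ are independent, and $W_{[K]}$ is independent of $\theta$. An unknown set $\mathcal B\subset[N]$ with $|\mathcal B|\le B$ of servers is Byzantine. They communicate only before the scheme starts and do not share queries during it: server $n\in\mathcal B$ answers with an arbitrary function of $S_{\mathcal B}$, $Z_{\mathcal B}$, its own query $Q_n^{[\theta]}$ and a variable $\gamma_n$, where $(\gamma_n)_{n\in\mathcal B}$ has an arbitrary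 finitely supported joint law and is independent of all of the above. The scheme is valid if, for every such $\mathcal B$, every behaviour of the Byzantine servers and every $\theta\in[K]$: (i) $I(S_{\mathcal B};W_{[K]})=0$ and $I(A^{[\theta]}_{\mathcal B};W_{[K]})=0$; (ii) $I(Q_n^{[\theta]};\theta)=0$ for every $n\in[N]$ (here $\theta$ is uniform on $[K]$); (iii) the decoder, which does not depend on $\mathcal B$ or on the behaviour, outputs $W_\theta$ with probability $1$; (iv) $I(W_{[K]\setminus\{\theta\}};A^{[\theta]}_{[N]},Q^{[\theta]}_{[N]})=0$. The rate of a scheme is $L/\sum_{n=1}^N H(A_n^{[\theta]})$, with the entropies of the honest answers in base $q$, and $C_{BSPIR}(B,N,K)$ is the supremum of the rates of all valid schemes with $K$ messages (over all $L$ and $q$; it is $0$ if there is no valid scheme). Then $$C_{BSPIR}(B,N,\infty)=\lim_{K\to\infty}C_{BSPIR}(B,N,K)=1-\frac{3B+1}{N}.$$ -/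

import Mathlib

open scoped ENNReal

noncomputable section

namespace ByzantineSPIR

/-! ### Shannon entropy and mutual information of discrete random variables -/

/-- Shannon entropy (in nats) of the random variable `X` on the discrete probability space `p`.
All the random variables below take only finitely many values with positive probability, so the
sum is finite. -/
def entropy {Ω α : Type} (p : PMF Ω) (X : Ω → α) : ℝ :=
  ∑' x, Real.negMulLog (p.map X x).toReal

/-- Mutual information `I(X;Y) = H(X) + H(Y) - H(X,Y)`. -/
def mutualInfo {Ω α β : Type} (p : PMF Ω) (X : Ω → α) (Y : Ω → β) : ℝ :=
  entropy p X + entropy p Y - entropy p (fun ω => (X ω, Y ω))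

/-! ### Schemes -/

/-- The data of a one-round retrieval scheme with `N` servers and `K` messages.  Each message
consists of `L` symbols of the finite alphabet `Sym`.  Transmitted answers are natural numbers, so
that a server which does not follow the protocol can send a symbol of any alphabet whatsoever. -/
structure Scheme (N K : ℕ) where
  /-- alphabet of the message symbols -/
  Sym : Type
  [fintypeSym : Fintype Sym]
  [nontrivialSym : Nontrivial Sym]
  /-- length of a message -/
  L : ℕ
  L_pos : 0 < L
  /-- alphabet of the contents of a server -/
  Sto : Type
  [finiteSto : Finite Sto]
  /-- alphabet of the masking variables -/
  Mask : Type
  [finiteMask : Finite Mask]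
  /-- alphabet of the queries -/
  Qry : Type
  [finiteQry : Finite Qry]
  /-- (randomized) distribution of the messages over the servers -/
  storage : (Fin K → Fin L → Sym) → PMF (Fin N → Sto)
  /-- joint law of the masking variables given to the servers -/
  mask : PMF (Fin N → Mask)
  /-- joint law of the queries when the user wants message `θ` -/
  query : Fin K → PMF (Fin N → Qry)
  /-- answer of an honest server, from its own storage, query and masking variable -/
  answer : Fin N → Sto → Qry → Mask → ℕ
  /-- the user's decoder, applied to the desired index, all queries and all received answers -/
  decode : Fin K → (Fin N → Qry) → (Fin N → ℕ) → Fin L → Sym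

attribute [instance] Scheme.fintypeSym Scheme.nontrivialSym Scheme.finiteSto Scheme.finiteMask
  Scheme.finiteQry

namespace Scheme

variable {N K : ℕ}

/-- A realization of everything that is random when no server deviates. -/
structure Outcome (s : Scheme N K) where
  /-- the desired index -/
  θ : Fin K
  /-- the messages -/
  W : Fin K → Fin s.L → s.Sym
  /-- the contents of the servers -/
  S : Fin N → s.Sto
  /-- the masking variables -/
  Z : Fin N → s.Mask
  /-- the queries -/
  Q : Fin N → s.Qry

/-- Joint law when message `θ` is desired: the messages are independent and uniform, the storage
is produced from the messages, and the masking variables and the queries are independent of the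
messages and the storage and of each other. -/
def lawGiven (s : Scheme N K) (θ : Fin K) : PMF s.Outcome :=
  (PMF.uniformOfFintype (Fin K → Fin s.L → s.Sym)).bind fun W =>
    (s.storage W).bind fun S =>
      s.mask.bind fun Z =>
        (s.query θ).bind fun Q =>
          PMF.pure ⟨θ, W, S, Z, Q⟩

/-- Joint law when the desired index is uniform on the `K` indices. -/
def law [NeZero K] (s : Scheme N K) : PMF s.Outcome :=
  (PMF.uniformOfFintype (Fin K)).bind s.lawGiven

/-- The answer that server `n` sends if it is honest. -/
def honestAnswer (s : Scheme N K) (n : Fin N) (o : s.Outcome) : ℕ :=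
  s.answer n (o.S n) (o.Q n) (o.Z n)

/-- A behaviour of the set `𝓑` of Byzantine servers that communicate only before the scheme is
initiated: they agree on a plan, that is, on arbitrarily correlated random variables `γ n`, and
share their storage and their masking variables.  During the scheme they do not communicate, so
that server `n` knows its own query only. -/
structure Attack (s : Scheme N K) (𝓑 : Finset (Fin N)) where
  /-- alphabet of the variables `γ n` -/
  Γ : Type
  [finiteΓ : Finite Γ]
  /-- joint law of the variables `γ n` -/
  plan : PMF (𝓑 → Γ)
  /-- answer of server `n`, from the shared storage, the shared masking variables, its own query
  and `γ n` -/
  respond : 𝓑 → (𝓑 → s.Sto) → (𝓑 → s.Mask) → s.Qry → Γ → ℕ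

/-- Joint law, given the desired index, of the outcome and of the Byzantine servers' `γ`, which is
independent of the outcome. -/
def attackLaw (s : Scheme N K) {𝓑 : Finset (Fin N)} (a : s.Attack 𝓑) (θ : Fin K) :
    PMF (s.Outcome × (𝓑 → a.Γ)) :=
  (s.lawGiven θ).bind fun o => a.plan.bind fun γ => PMF.pure (o, γ)

/-- The answers received by the user under the attack `a`. -/
def received (s : Scheme N K) {𝓑 : Finset (Fin N)} (a : s.Attack 𝓑)
    (x : s.Outcome × (𝓑 → a.Γ)) (n : Fin N) : ℕ :=
  if h : n ∈ 𝓑 then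
    a.respond ⟨n, h⟩ (fun m => x.1.S m) (fun m => x.1.Z m) (x.1.Q n) (x.2 ⟨n, h⟩)
  else s.honestAnswer n x.1

/-- The scheme is a symmetric private information retrieval scheme against any `B` Byzantine
servers that communicate only before the scheme is initiated. -/
structure IsValid [NeZero K] (s : Scheme N K) (B : ℕ) : Prop where
  /-- `I(S_𝓑 ; W_[K]) = 0` -/
  storage_secure : ∀ 𝓑 : Finset (Fin N), 𝓑.card ≤ B →
    mutualInfo s.law (fun o => fun m : 𝓑 => o.S m) (fun o => o.W) = 0
  /-- `I(A_𝓑 ; W_[K]) = 0`, whatever the Byzantine servers `𝓑` send -/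
  no_leak : ∀ 𝓑 : Finset (Fin N), 𝓑.card ≤ B → ∀ (a : s.Attack 𝓑) (θ : Fin K),
    mutualInfo (s.attackLaw a θ) (fun x => fun m : 𝓑 => s.received a x m) (fun x => x.1.W) = 0
  /-- `I(Q_n ; θ) = 0` for every single server -/
  user_private : ∀ n : Fin N, mutualInfo s.law (fun o => o.Q n) (fun o => o.θ) = 0
  /-- the user, who knows neither `𝓑` nor the attack, recovers `W_θ` without error -/
  correct : ∀ 𝓑 : Finset (Fin N), 𝓑.card ≤ B → ∀ (a : s.Attack 𝓑) (θ : Fin K),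
    ∀ x ∈ (s.attackLaw a θ).support, s.decode θ x.1.Q (s.received a x) = x.1.W θ
  /-- `I(W_{[K] without θ} ; A_[N], Q_[N]) = 0`, whatever the Byzantine servers send -/
  symmetric_private : ∀ 𝓑 : Finset (Fin N), 𝓑.card ≤ B → ∀ (a : s.Attack 𝓑) (θ : Fin K),
    mutualInfo (s.attackLaw a θ) (fun x => fun k : {k : Fin K // k ≠ θ} => x.1.W k)
      (fun x => (s.received a x, x.1.Q)) = 0

/-- The rate `L / ∑ n, H(A_n)`, with the entropies of the prescribed answers measured in symbols
of the message alphabet. -/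
def rate [NeZero K] (s : Scheme N K) : ℝ≥0∞ :=
  (s.L : ℝ≥0∞) / ENNReal.ofReal
    ((∑ n, entropy s.law (s.honestAnswer n)) / Real.log (Fintype.card s.Sym))

end Scheme

/-- The capacity for `K` messages: the supremum of the rates of all valid schemes (`0` if there is
none). -/
def capacity (N B K : ℕ) [NeZero K] : ℝ≥0∞ :=
  ⨆ (s : Scheme N K) (_ : s.IsValid B), s.rate

end ByzantineSPIR

end

noncomputable section

namespace ByzantineSPIR

/-! ### Entropy inequalities and independence for finite sample spaces -/

section Entropy

variable {Ω α β γ : Type}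

/-! Write M = N - 3B, and let α_n and f_j be distinct field points attached to the servers and to
the message symbols.

Converse. Split the servers into any set R of size M and three sets T, D₁, D₂ of size B. Suppose two
worlds with the same masks and queries agree on the storage of T and on the answers of R. The user
cannot distinguish the first world, with D₂ replaying the second, from the second world, with D₁
replaying the first. Zero-error decoding therefore forces the same W_θ (`message_eq_of_answers_eq`).
So, given S_T, which is independent of the messages, the answers of R determine W_θ, as in ordinary
private retrieval from M servers. The classical induction on messages applies
(`geometric_lower_bound`): if G k is the sum over R of the entropies of single answers given S_T and
the first k messages, then G k ≥ L log q + G (k+1) / M. Averaging over R bounds the rate by (M/N) /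
(1 + 1/M + ... + 1/M^(K-1)), which tends to (M-1)/N.

Achievability. Cross-subspace alignment with ℓ = N - 3B - 1 symbols per message has rate at least
ℓ/N = (M-1)/N for every K. An honest answer is Σ_j W_θ,j / (f_j - α_n) plus the value at α_n of a
polynomial of degree at most B (`sum_shares_mul_queries`). Such words differ in more than 2B places
whenever their symbols differ (`codeword_unique`), so B wrong answers are corrected. A uniform
polynomial mask absorbs the interference. Every secrecy condition follows by translating the uniform
randomness so that the view under one message tuple becomes the view under another. -/

lemma sum_toReal_eq_one [Fintype α] (p : PMF α) : ∑ x, (p x).toReal = 1 := by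
  rw [← ENNReal.toReal_sum (fun a _ => p.apply_ne_top a), ← tsum_fintype (L := .unconditional _),
    p.tsum_coe, ENNReal.toReal_one]

lemma bind_toReal [Fintype α] (μ : PMF α) (f : α → PMF β) (b : β) :
    (μ.bind f b).toReal = ∑ a, (μ a).toReal * (f a b).toReal := by
  rw [PMF.bind_apply, tsum_fintype, ENNReal.toReal_sum]
  · simp
  · exact fun a _ => ENNReal.mul_ne_top (μ.apply_ne_top a) ((f a).apply_ne_top b)

lemma map_toReal [Fintype Ω] [DecidableEq α] (p : PMF Ω) (X : Ω → α) (x : α) :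
    (p.map X x).toReal = ∑ ω, if x = X ω then (p ω).toReal else 0 := by
  rw [PMF.map_apply, tsum_fintype, ENNReal.toReal_sum]
  · refine Finset.sum_congr rfl fun ω _ => ?_
    split_ifs <;> simp
  · intro ω _
    split_ifs
    · exact p.apply_ne_top ω
    · simp

lemma map_eq_zero_of_forall_ne (p : PMF Ω) {X : Ω → α} {x : α} (h : ∀ ω, X ω ≠ x) :
    p.map X x = 0 := by
  rw [PMF.apply_eq_zero_iff, PMF.mem_support_map_iff]
  rintro ⟨ω, -, hω⟩
  exact h ω hω

/-- Entropy as a sum over any finite set that contains all values. -/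
lemma entropy_eq_sum_of_mem (p : PMF Ω) {X : Ω → α} {s : Finset α} (h : ∀ ω, X ω ∈ s) :
    entropy p X = ∑ x ∈ s, Real.negMulLog (p.map X x).toReal := by
  refine tsum_eq_sum fun x hx => ?_
  rw [map_eq_zero_of_forall_ne p (fun ω (hω : X ω = x) => hx (hω ▸ h ω))]
  simp

lemma entropy_map {Ω' : Type} (p : PMF Ω) (g : Ω → Ω') (X : Ω' → α) :
    entropy (p.map g) X = entropy p (X ∘ g) := by
  simp only [entropy, PMF.map_comp]

open Classical in
/-- Entropy as the expectation of the logarithmic loss. -/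
lemma entropy_eq_neg_sum_log [Fintype Ω] (p : PMF Ω) (X : Ω → α) :
    entropy p X = -∑ ω, (p ω).toReal * Real.log (p.map X (X ω)).toReal := by
  rw [entropy_eq_sum_of_mem p (s := Finset.univ.image X) (by simp),
    ← Finset.sum_fiberwise_of_maps_to (t := Finset.univ.image X) (g := X) (by simp),
    ← Finset.sum_neg_distrib]
  refine Finset.sum_congr rfl fun x _ => ?_
  rw [Real.negMulLog, map_toReal, Finset.sum_filter, neg_mul, neg_inj, Finset.sum_mul]
  refine Finset.sum_congr rfl fun ω _ => ?_
  by_cases hω : X ω = x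
  · subst hω
    rw [if_pos rfl, if_pos rfl, map_toReal]
  · simp [hω, Ne.symm hω]

lemma map_toReal_pos [Fintype Ω] (p : PMF Ω) (X : Ω → α) {ω : Ω} (h : p ω ≠ 0) :
    0 < (p.map X (X ω)).toReal := by
  refine ENNReal.toReal_pos (fun h0 => ?_) (PMF.apply_ne_top _ _)
  rw [PMF.apply_eq_zero_iff, PMF.mem_support_map_iff] at h0
  exact h0 ⟨ω, h, rfl⟩

lemma toReal_le_one (p : PMF α) (x : α) : (p x).toReal ≤ 1 :=
  ENNReal.toReal_mono ENNReal.one_ne_top (p.coe_le_one x)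

lemma entropy_nonneg (p : PMF Ω) (X : Ω → α) : 0 ≤ entropy p X :=
  tsum_nonneg fun _ => Real.negMulLog_nonneg ENNReal.toReal_nonneg (toReal_le_one _ _)

open Classical in
/-- Refining the partition of the sample space increases the entropy. -/
lemma entropy_mono [Finite Ω] (p : PMF Ω) {X : Ω → α} {Y : Ω → β}
    (h : ∀ ω ∈ p.support, ∀ ω' ∈ p.support, Y ω = Y ω' → X ω = X ω') :
    entropy p X ≤ entropy p Y := by
  have := Fintype.ofFinite Ω
  rw [entropy_eq_neg_sum_log, entropy_eq_neg_sum_log, neg_le_neg_iff]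
  refine Finset.sum_le_sum fun ω _ => ?_
  by_cases hω : p ω = 0
  · simp [hω]
  refine mul_le_mul_of_nonneg_left (Real.log_le_log (map_toReal_pos p Y hω) ?_)
    ENNReal.toReal_nonneg
  rw [map_toReal, map_toReal]
  refine Finset.sum_le_sum fun ω' _ => ?_
  by_cases hω' : p ω' = 0
  · simp [hω']
  by_cases hY : Y ω = Y ω'
  · rw [if_pos hY, if_pos (h ω hω ω' hω' hY)]
  · rw [if_neg hY]
    positivity

/-- Entropy depends only on the partition of the support, so tuples may be regrouped and redundant
components dropped. -/
lemma entropy_congr [Finite Ω] (p : PMF Ω) {X : Ω → α} {Y : Ω → β}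
    (h : ∀ ω ∈ p.support, ∀ ω' ∈ p.support, X ω = X ω' ↔ Y ω = Y ω') :
    entropy p X = entropy p Y :=
  le_antisymm (entropy_mono p fun ω hω ω' hω' => (h ω hω ω' hω').2)
    (entropy_mono p fun ω hω ω' hω' => (h ω hω ω' hω').1)

open Classical in
/-- Submodularity of entropy, that is, `I(X;Y|Z) ≥ 0`. -/
theorem entropy_submodular [Finite Ω] (p : PMF Ω) (X : Ω → α) (Y : Ω → β) (Z : Ω → γ) :
    entropy p (fun ω => (X ω, Y ω, Z ω)) + entropy p Z ≤
      entropy p (fun ω => (X ω, Z ω)) + entropy p (fun ω => (Y ω, Z ω)) := by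
  have := Fintype.ofFinite Ω
  set w : Ω → ℝ := fun ω => (p ω).toReal with hw
  have hw0 : ∀ ω, 0 ≤ w ω := fun ω => ENNReal.toReal_nonneg
  set A : Ω → ℝ := fun ω => (p.map (fun ω => (X ω, Z ω)) (X ω, Z ω)).toReal with hA
  set B : Ω → ℝ := fun ω => (p.map (fun ω => (Y ω, Z ω)) (Y ω, Z ω)).toReal with hB
  set C : Ω → ℝ := fun ω => (p.map (fun ω => (X ω, Y ω, Z ω)) (X ω, Y ω, Z ω)).toReal with hC
  set D : Ω → ℝ := fun ω => (p.map Z (Z ω)).toReal with hD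
  -- The claim is E[-log r] ≥ 0 for r = p(x,z) p(y,z) / (p(x,y,z) p(z)). By log r ≤ r - 1 it is
  -- enough that E[r] ≤ 1. Expanding A and B over two independent copies a, b of ω leaves the sum of
  -- w/C over one cell of (X,Y,Z), which is 1 or 0.
  have key : ∑ ω, w ω * (A ω * B ω / (C ω * D ω)) ≤ 1 := by
    have inner : ∀ a b, ∑ ω, (if (X ω, Z ω) = (X a, Z a) then (1 : ℝ) else 0) *
        (if (Y ω, Z ω) = (Y b, Z b) then 1 else 0) * (w ω / (C ω * D ω)) ≤
        (if Z a = Z b then 1 else 0) / D a := by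
      intro a b
      by_cases hab : Z a = Z b
      · rw [if_pos hab]
        by_cases hne : ∃ c, X c = X a ∧ Z c = Z a ∧ Y c = Y b
        · obtain ⟨c, hc1, hc2, hc3⟩ := hne
          have e : ∀ ω, (if (X ω, Z ω) = (X a, Z a) then (1 : ℝ) else 0) *
              (if (Y ω, Z ω) = (Y b, Z b) then 1 else 0) * (w ω / (C ω * D ω)) =
              (if (X c, Y c, Z c) = (X ω, Y ω, Z ω) then w ω else 0) * (1 / (C c * D a)) := by
            intro ω
            by_cases h : (X c, Y c, Z c) = (X ω, Y ω, Z ω)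
            · have h' := h
              simp only [Prod.mk.injEq] at h
              obtain ⟨h1, h2, h3⟩ := h
              have hCc : C ω = C c := by simp only [hC, h']
              have hDc : D ω = D a := by simp only [hD, ← h3, hc2]
              rw [if_pos h', if_pos (by rw [← h1, ← h3, hc1, hc2]),
                if_pos (by rw [← h2, ← h3, hc3, hc2, hab]), hCc, hDc]
              ring
            · rw [if_neg h]
              by_cases h1 : (X ω, Z ω) = (X a, Z a)
              · by_cases h2 : (Y ω, Z ω) = (Y b, Z b)
                · simp only [Prod.mk.injEq] at h1 h2 h
                  exact absurd ⟨by rw [h1.1, hc1], by rw [h2.1, hc3], by rw [h1.2, hc2]⟩ h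
                · simp [h2]
              · simp [h1]
          rw [Finset.sum_congr rfl fun ω _ => e ω, ← Finset.sum_mul]
          have : (∑ ω, if (X c, Y c, Z c) = (X ω, Y ω, Z ω) then w ω else 0) = C c := by
            simp only [hC, map_toReal, hw]
          rw [this]
          have hCn : 0 ≤ C c := ENNReal.toReal_nonneg
          have hDn : 0 ≤ D a := ENNReal.toReal_nonneg
          rcases hCn.eq_or_lt with h0 | h0
          · rw [← h0, zero_mul]; positivity
          · rw [one_div, mul_inv, ← mul_assoc, mul_inv_cancel₀ h0.ne', one_mul, one_div]
        · push Not at hne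
          refine le_trans (Finset.sum_nonpos fun ω _ => ?_) (by positivity)
          by_cases h1 : (X ω, Z ω) = (X a, Z a)
          · by_cases h2 : (Y ω, Z ω) = (Y b, Z b)
            · simp only [Prod.mk.injEq] at h1 h2
              exact absurd h2.1 (hne ω h1.1 h1.2)
            · simp [h2]
          · simp [h1]
      · rw [if_neg hab, zero_div]
        refine Finset.sum_nonpos fun ω _ => ?_
        by_cases h1 : (X ω, Z ω) = (X a, Z a)
        · by_cases h2 : (Y ω, Z ω) = (Y b, Z b)
          · simp only [Prod.mk.injEq] at h1 h2
            exact absurd (h1.2.symm.trans h2.2) hab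
          · simp [h2]
        · simp [h1]
    have hA' : ∀ ω, A ω = ∑ a, w a * (if (X ω, Z ω) = (X a, Z a) then (1 : ℝ) else 0) := by
      intro ω
      simp only [hA, map_toReal, hw, mul_ite, mul_one, mul_zero]
    have hB' : ∀ ω, B ω = ∑ b, w b * (if (Y ω, Z ω) = (Y b, Z b) then (1 : ℝ) else 0) := by
      intro ω
      simp only [hB, map_toReal, hw, mul_ite, mul_one, mul_zero]
    calc ∑ ω, w ω * (A ω * B ω / (C ω * D ω))
        = ∑ ω, ∑ a, ∑ b, w a * w b * ((if (X ω, Z ω) = (X a, Z a) then (1 : ℝ) else 0) *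
          (if (Y ω, Z ω) = (Y b, Z b) then 1 else 0) * (w ω / (C ω * D ω))) := by
          refine Finset.sum_congr rfl fun ω _ => ?_
          rw [show w ω * (A ω * B ω / (C ω * D ω)) = A ω * B ω * (w ω / (C ω * D ω)) by ring,
            hA', hB', Finset.sum_mul_sum, Finset.sum_mul]
          refine Finset.sum_congr rfl fun a _ => ?_
          rw [Finset.sum_mul]
          exact Finset.sum_congr rfl fun b _ => by ring
      _ = ∑ a, ∑ b, w a * w b * ∑ ω, ((if (X ω, Z ω) = (X a, Z a) then (1 : ℝ) else 0) *
          (if (Y ω, Z ω) = (Y b, Z b) then 1 else 0) * (w ω / (C ω * D ω))) := by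
          rw [Finset.sum_comm]
          refine Finset.sum_congr rfl fun a _ => ?_
          rw [Finset.sum_comm]
          exact Finset.sum_congr rfl fun b _ => by rw [Finset.mul_sum]
      _ ≤ ∑ a, ∑ b, w a * w b * ((if Z a = Z b then 1 else 0) / D a) :=
          Finset.sum_le_sum fun a _ => Finset.sum_le_sum fun b _ =>
            mul_le_mul_of_nonneg_left (inner a b) (mul_nonneg (hw0 a) (hw0 b))
      _ = ∑ a, w a * (D a / D a) := by
          refine Finset.sum_congr rfl fun a _ => ?_
          have : D a = ∑ b, if Z a = Z b then w b else 0 := by simp only [hD, map_toReal, hw]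
          conv_rhs => rw [show w a * (D a / D a) = (w a / D a) * D a by ring]
          rw [this, Finset.mul_sum, ← this]
          refine Finset.sum_congr rfl fun b _ => ?_
          split_ifs <;> ring
      _ ≤ ∑ a, w a := Finset.sum_le_sum fun a _ =>
          mul_le_of_le_one_right (hw0 a) (div_self_le_one _)
      _ = 1 := sum_toReal_eq_one p
  have hterm : ∀ ω, w ω * (Real.log (A ω) + Real.log (B ω) - Real.log (C ω) - Real.log (D ω)) ≤
      w ω * (A ω * B ω / (C ω * D ω)) - w ω := by
    intro ω
    by_cases hω : p ω = 0
    · simp [hw, hω]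
    have hAp : 0 < A ω := map_toReal_pos p (fun ω => (X ω, Z ω)) hω
    have hBp : 0 < B ω := map_toReal_pos p (fun ω => (Y ω, Z ω)) hω
    have hCp : 0 < C ω := map_toReal_pos p (fun ω => (X ω, Y ω, Z ω)) hω
    have hDp : 0 < D ω := map_toReal_pos p Z hω
    have := Real.log_le_sub_one_of_pos (show 0 < A ω * B ω / (C ω * D ω) by positivity)
    rw [Real.log_div (by positivity) (by positivity), Real.log_mul hAp.ne' hBp.ne',
      Real.log_mul hCp.ne' hDp.ne'] at this
    have h2 := mul_le_mul_of_nonneg_left this (hw0 ω)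
    linarith
  have hsum := Finset.sum_le_sum fun ω (_ : ω ∈ Finset.univ) => hterm ω
  rw [Finset.sum_sub_distrib, show ∑ ω, w ω = 1 from sum_toReal_eq_one p] at hsum
  simp only [mul_sub, mul_add, Finset.sum_sub_distrib, Finset.sum_add_distrib] at hsum
  simp only [entropy_eq_neg_sum_log]
  change -(∑ ω, w ω * Real.log (C ω)) + -(∑ ω, w ω * Real.log (D ω)) ≤
    -(∑ ω, w ω * Real.log (A ω)) + -(∑ ω, w ω * Real.log (B ω))
  linarith

lemma sum_map_toReal [Finite Ω] (p : PMF Ω) {X : Ω → α} {s : Finset α} (h : ∀ ω, X ω ∈ s) :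
    ∑ x ∈ s, (p.map X x).toReal = 1 := by
  rw [← ENNReal.toReal_sum (fun a _ => PMF.apply_ne_top _ a), 
    ← tsum_eq_sum (L := .unconditional _) (fun x hx => map_eq_zero_of_forall_ne p
      (fun ω (hω : X ω = x) => hx (hω ▸ h ω))), PMF.tsum_coe, ENNReal.toReal_one]

/-- A variable that takes at most `#s` values has entropy at most `log #s`. -/
lemma entropy_le_log_card [Finite Ω] (p : PMF Ω) {X : Ω → α} {s : Finset α} (h : ∀ ω, X ω ∈ s) :
    entropy p X ≤ Real.log s.card := by
  rw [entropy_eq_sum_of_mem p h]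
  have hs : 0 < (s.card : ℝ) := by
    obtain ⟨ω, -⟩ := p.support_nonempty
    exact_mod_cast Finset.card_pos.2 ⟨X ω, h ω⟩
  -- Gibbs' inequality against the uniform law on `s`, termwise; the correction terms cancel in the
  -- sum.
  have hterm : ∀ x ∈ s, Real.negMulLog (p.map X x).toReal ≤
      (p.map X x).toReal * Real.log s.card + ((s.card : ℝ)⁻¹ - (p.map X x).toReal) := by
    intro x _
    rcases (ENNReal.toReal_nonneg (a := p.map X x)).eq_or_lt with h0 | h0
    · rw [← h0]; simp
    · set r := (p.map X x).toReal
      have := Real.log_le_sub_one_of_pos (show 0 < (r * s.card)⁻¹ by positivity)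
      rw [Real.log_inv, Real.log_mul h0.ne' hs.ne'] at this
      have h2 := mul_le_mul_of_nonneg_left this h0.le
      have h3 : r * ((r * s.card)⁻¹ - 1) = (s.card : ℝ)⁻¹ - r := by field_simp
      rw [h3] at h2
      rw [Real.negMulLog]
      linarith
  refine (Finset.sum_le_sum hterm).trans ?_
  rw [Finset.sum_add_distrib, ← Finset.sum_mul, Finset.sum_sub_distrib, sum_map_toReal p h,
    Finset.sum_const, nsmul_eq_mul, mul_inv_cancel₀ hs.ne']
  linarith

/-- Concavity of entropy: conditioning on the index of a mixture decreases the entropy. -/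
lemma sum_mul_entropy_le_entropy_bind {ι : Type} [Fintype ι] [Finite Ω] (μ : PMF ι)
    (f : ι → PMF Ω) (X : Ω → α) :
    ∑ i, (μ i).toReal * entropy (f i) X ≤ entropy (μ.bind f) X := by
  classical
  have := Fintype.ofFinite Ω
  have hX : ∀ ω, X ω ∈ Finset.univ.image X := by simp
  simp only [entropy_eq_sum_of_mem _ hX, Finset.mul_sum]
  rw [Finset.sum_comm]
  refine Finset.sum_le_sum fun x _ => ?_
  rw [PMF.map_bind, bind_toReal]
  have := Real.concaveOn_negMulLog.le_map_sum (t := Finset.univ) (w := fun i => (μ i).toReal)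
    (p := fun i => ((f i).map X x).toReal) (fun i _ => ENNReal.toReal_nonneg)
    (sum_toReal_eq_one μ) (fun i _ => ENNReal.toReal_nonneg)
  simpa using this

/-- If the joint law does not depend on the value of `Y`, then `Y` is uniform and independent
of `X`. -/
lemma mutualInfo_eq_zero_of_const [Finite Ω] [Finite β] (p : PMF Ω) (X : Ω → α) (Y : Ω → β)
    (h : ∀ x y y', p.map (fun ω => (X ω, Y ω)) (x, y) = p.map (fun ω => (X ω, Y ω)) (x, y')) :
    mutualInfo p X Y = 0 := by
  classical
  have := Fintype.ofFinite Ω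
  have := Fintype.ofFinite β
  obtain ⟨ω₀, -⟩ := p.support_nonempty
  set s := Finset.univ.image X
  have hX : ∀ ω, X ω ∈ s := by simp [s]
  set J : α → β → ℝ := fun x y => (p.map (fun ω => (X ω, Y ω)) (x, y)).toReal with hJ
  have hm : (0 : ℝ) < Fintype.card β := by
    exact_mod_cast Fintype.card_pos_iff.2 ⟨Y ω₀⟩
  set m : ℝ := (Fintype.card β : ℝ)
  have hPX : ∀ x, (p.map X x).toReal = ∑ y, J x y := by
    intro x
    simp only [hJ, map_toReal]
    rw [Finset.sum_comm]
    refine Finset.sum_congr rfl fun ω _ => ?_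
    by_cases hx : x = X ω
    · subst hx; simp
    · simp [hx]
  have hPY : ∀ y, (p.map Y y).toReal = ∑ x ∈ s, J x y := by
    intro y
    simp only [hJ, map_toReal]
    rw [Finset.sum_comm]
    refine Finset.sum_congr rfl fun ω _ => ?_
    by_cases hy : y = Y ω
    · subst hy; simp [hX ω]
    · simp [hy]
  have hJX : ∀ x y, J x y = (p.map X x).toReal / m := by
    intro x y
    have : ∀ y' ∈ Finset.univ, J x y' = J x y := fun y' _ => by simp only [hJ, h x y' y]
    rw [hPX, Finset.sum_congr rfl this, Finset.sum_const, nsmul_eq_mul, Finset.card_univ]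
    exact (mul_div_cancel_left₀ _ hm.ne').symm
  have hY : ∀ y, (p.map Y y).toReal = m⁻¹ := by
    intro y
    rw [hPY]
    simp only [hJX]
    rw [← Finset.sum_div, sum_map_toReal p hX, one_div]
  rw [mutualInfo, entropy_eq_sum_of_mem p hX, entropy_eq_sum_of_mem p (s := Finset.univ)
    (X := Y) (by simp), entropy_eq_sum_of_mem p (s := s ×ˢ Finset.univ) (by simp [hX]),
    Finset.sum_product]
  have e1 : ∀ x ∈ s, ∑ y, Real.negMulLog (p.map (fun ω => (X ω, Y ω)) (x, y)).toReal =
      Real.negMulLog (p.map X x).toReal + (p.map X x).toReal * Real.log m := by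
    intro x _
    have : ∀ y ∈ Finset.univ, Real.negMulLog (p.map (fun ω => (X ω, Y ω)) (x, y)).toReal =
        Real.negMulLog ((p.map X x).toReal / m) := fun y _ => by
      rw [← hJX x y]
    rw [Finset.sum_congr rfl this, Finset.sum_const, nsmul_eq_mul, Finset.card_univ]
    change m * _ = _
    rcases eq_or_ne (p.map X x).toReal 0 with h0 | h0
    · rw [h0]; simp
    · rw [Real.negMulLog, Real.negMulLog, Real.log_div h0 hm.ne']
      field_simp
      ring
  rw [Finset.sum_congr rfl e1, Finset.sum_add_distrib, ← Finset.sum_mul, sum_map_toReal p hX]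
  simp only [hY, Finset.sum_const, nsmul_eq_mul, Finset.card_univ, Real.negMulLog, Real.log_inv]
  change _ + m * _ - _ = _
  field_simp
  ring

lemma mutualInfo_comm [Finite Ω] (p : PMF Ω) (X : Ω → α) (Y : Ω → β) :
    mutualInfo p X Y = mutualInfo p Y X := by
  rw [mutualInfo, mutualInfo, add_comm (entropy p X), entropy_congr p (X := fun ω => (X ω, Y ω))
    (Y := fun ω => (Y ω, X ω)) (by simp [and_comm])]

/-- Vanishing mutual information means independence. -/
lemma map_prod_eq_mul_of_mutualInfo_eq_zero [Finite Ω] [Finite α] [Finite β] (p : PMF Ω)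
    (X : Ω → α) (Y : Ω → β) (h : mutualInfo p X Y = 0) (x : α) (y : β) :
    (p.map (fun ω => (X ω, Y ω)) (x, y)).toReal = (p.map X x).toReal * (p.map Y y).toReal := by
  classical
  have := Fintype.ofFinite Ω
  have := Fintype.ofFinite α
  have := Fintype.ofFinite β
  set J : α → β → ℝ := fun x y => (p.map (fun ω => (X ω, Y ω)) (x, y)).toReal with hJ
  set a : α → ℝ := fun x => (p.map X x).toReal with ha
  set b : β → ℝ := fun y => (p.map Y y).toReal with hb
  have hPX : ∀ x, a x = ∑ y, J x y := by
    intro x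
    simp only [hJ, ha, map_toReal]
    rw [Finset.sum_comm]
    refine Finset.sum_congr rfl fun ω _ => ?_
    by_cases hx : x = X ω
    · subst hx; simp
    · simp [hx]
  have hPY : ∀ y, b y = ∑ x, J x y := by
    intro y
    simp only [hJ, hb, map_toReal]
    rw [Finset.sum_comm]
    refine Finset.sum_congr rfl fun ω _ => ?_
    by_cases hy : y = Y ω
    · subst hy; simp
    · simp [hy]
  have hJ0 : ∀ x y, 0 ≤ J x y := fun x y => ENNReal.toReal_nonneg
  have ha1 : ∑ x, a x = 1 := sum_toReal_eq_one _
  have hb1 : ∑ y, b y = 1 := sum_toReal_eq_one _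
  -- The integrand of the divergence of J from the product of its marginals. The added a x * b y - J
  -- x y sums to zero and makes every term nonnegative, so zero total forces each term to vanish.
  set t : α → β → ℝ := fun x y =>
    J x y * Real.log (J x y) - J x y * Real.log (a x) - J x y * Real.log (b y) +
      a x * b y - J x y with ht
  have hkl : ∀ x y, a x * b y ≠ 0 →
      t x y = a x * b y * InformationTheory.klFun (J x y / (a x * b y)) := by
    intro x y hab
    have h1 := left_ne_zero_of_mul hab
    have h2 := right_ne_zero_of_mul hab
    rcases eq_or_ne (J x y) 0 with h0 | h0
    · simp [ht, h0, InformationTheory.klFun]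
    · simp only [ht, InformationTheory.klFun]
      rw [Real.log_div h0 hab, Real.log_mul h1 h2]
      field_simp
      ring
  have hz : ∀ x y, a x * b y = 0 → J x y = 0 := by
    intro x y hab
    rcases mul_eq_zero.1 hab with h0 | h0
    · rw [hPX, Finset.sum_eq_zero_iff_of_nonneg (fun y _ => hJ0 x y)] at h0
      exact h0 y (Finset.mem_univ _)
    · rw [hPY, Finset.sum_eq_zero_iff_of_nonneg (fun x _ => hJ0 x y)] at h0
      exact h0 x (Finset.mem_univ _)
  have hab0 : ∀ x y, 0 ≤ a x * b y := fun x y =>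
    mul_nonneg ENNReal.toReal_nonneg ENNReal.toReal_nonneg
  have ht0 : ∀ x y, 0 ≤ t x y := by
    intro x y
    rcases eq_or_ne (a x * b y) 0 with h0 | h0
    · simp [ht, hz x y h0, h0]
    · rw [hkl x y h0]
      exact mul_nonneg (hab0 x y) (InformationTheory.klFun_nonneg (div_nonneg (hJ0 x y) (hab0 x y)))
  have hsum : ∑ x, ∑ y, t x y = 0 := by
    rw [mutualInfo, entropy_eq_sum_of_mem p (s := Finset.univ) (X := X) (by simp),
      entropy_eq_sum_of_mem p (s := Finset.univ) (X := Y) (by simp),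
      entropy_eq_sum_of_mem p (s := Finset.univ ×ˢ Finset.univ) (by simp),
      Finset.sum_product] at h
    have e1 : ∑ x, ∑ y, J x y * Real.log (a x) = -∑ x, Real.negMulLog (a x) := by
      rw [← Finset.sum_neg_distrib]
      refine Finset.sum_congr rfl fun x _ => ?_
      rw [← Finset.sum_mul, ← hPX, Real.negMulLog]; ring
    have e2 : ∑ x, ∑ y, J x y * Real.log (b y) = -∑ y, Real.negMulLog (b y) := by
      rw [Finset.sum_comm, ← Finset.sum_neg_distrib]
      refine Finset.sum_congr rfl fun y _ => ?_
      rw [← Finset.sum_mul, ← hPY, Real.negMulLog]; ring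
    have e3 : ∑ x, ∑ y, J x y * Real.log (J x y) = -∑ x, ∑ y, Real.negMulLog (J x y) := by
      simp [Real.negMulLog]
    have e4 : ∑ x, ∑ y, a x * b y = 1 := by
      rw [← Finset.sum_mul_sum, ha1, hb1, one_mul]
    have e5 : ∑ x, ∑ y, J x y = 1 := by
      simp only [← hPX, ha1]
    simp only [ht, Finset.sum_sub_distrib, Finset.sum_add_distrib]
    rw [e1, e2, e3, e4, e5]
    linarith
  have htxy : t x y = 0 := by
    rw [Finset.sum_eq_zero_iff_of_nonneg
      (fun x _ => Finset.sum_nonneg fun y _ => ht0 x y)] at hsum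
    have := hsum x (Finset.mem_univ _)
    rw [Finset.sum_eq_zero_iff_of_nonneg (fun y _ => ht0 x y)] at this
    exact this y (Finset.mem_univ _)
  change J x y = a x * b y
  rcases eq_or_ne (a x * b y) 0 with h0 | h0
  · rw [hz x y h0, h0]
  · rw [hkl x y h0, mul_eq_zero, or_iff_right h0,
      InformationTheory.klFun_eq_zero_iff (div_nonneg (hJ0 x y) (hab0 x y))] at htxy
    exact (div_eq_one_iff_eq h0).1 htxy

end Entropy


/-! ### Conditional entropy and the recursion over messages -/

section ConditionalEntropy

variable {Ω α β γ : Type}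

lemma entropy_pair_le [Finite Ω] (p : PMF Ω) (X : Ω → α) (Y : Ω → β) :
    entropy p (fun ω => (X ω, Y ω)) ≤ entropy p X + entropy p Y := by
  have h := entropy_submodular p X Y (fun _ => ())
  have h0 := entropy_nonneg p (fun _ => ())
  rw [entropy_congr p (X := fun ω => (X ω, Y ω, ())) (Y := fun ω => (X ω, Y ω)) (by simp),
    entropy_congr p (X := fun ω => (X ω, ())) (Y := X) (by simp),
    entropy_congr p (X := fun ω => (Y ω, ())) (Y := Y) (by simp)] at h
  linarith

lemma sum_map_mul [Fintype Ω] [Fintype α] (p : PMF Ω) (X : Ω → α) (g : α → ℝ) :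
    ∑ x, (p.map X x).toReal * g x = ∑ ω, (p ω).toReal * g (X ω) := by
  classical
  simp only [map_toReal, Finset.sum_mul]
  rw [Finset.sum_comm]
  refine Finset.sum_congr rfl fun ω _ => ?_
  simp [ite_mul]

lemma entropy_uniform [Fintype α] [Nonempty α] (p : PMF Ω) (X : Ω → α)
    (h : p.map X = PMF.uniformOfFintype α) : entropy p X = Real.log (Fintype.card α) := by
  classical
  rw [entropy_eq_sum_of_mem p (s := Finset.univ) (by simp), h]
  have hc : (Fintype.card α : ℝ) ≠ 0 := by exact_mod_cast Fintype.card_ne_zero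
  simp only [PMF.uniformOfFintype_apply, Finset.sum_const, Finset.card_univ, nsmul_eq_mul,
    Real.negMulLog, ENNReal.toReal_inv, ENNReal.toReal_natCast, Real.log_inv]
  field_simp

/-- Subadditivity of conditional entropy for a finite family of variables. -/
lemma condEntropy_family_le {ι : Type} [DecidableEq ι] [Finite Ω] (p : PMF Ω) (X : ι → Ω → ℕ)
    (V : Ω → β) (R : Finset ι) :
    entropy p (fun ω => (fun n => if n ∈ R then X n ω else 0, V ω)) - entropy p V ≤
      ∑ n ∈ R, (entropy p (fun ω => (X n ω, V ω)) - entropy p V) := by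
  induction R using Finset.induction_on with
  | empty =>
    rw [entropy_congr p (X := fun ω => (fun n => if n ∈ (∅ : Finset ι) then X n ω else 0, V ω))
      (Y := V) (by simp)]
    simp
  | insert a R ha ih =>
    rw [Finset.sum_insert ha]
    have h := entropy_submodular p (X a) (fun ω n => if n ∈ R then X n ω else 0) V
    rw [entropy_congr p (Y := fun ω => (fun n => if n ∈ insert a R then X n ω else 0, V ω))
      (X := fun ω => (X a ω, fun n => if n ∈ R then X n ω else 0, V ω))] at h
    · linarith
    · intro ω _ ω' _
      simp only [Prod.mk.injEq, funext_iff, Finset.mem_insert]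
      constructor
      · rintro ⟨h1, h2, h3⟩
        refine ⟨fun n => ?_, h3⟩
        by_cases hn : n = a
        · simp [hn, h1]
        · simpa [hn] using h2 n
      · rintro ⟨h1, h3⟩
        refine ⟨by simpa using h1 a, fun n => ?_, h3⟩
        by_cases hn : n ∈ R
        · simpa [hn] using h1 n
        · simp [hn]

/-- The recursion behind the converse: `V k` is the side information together with the first `k`
messages, `X n c` the answer of server `n` to the query `c`, and the `θ`-th message is determined
by the answers and `V θ`. -/
lemma geometric_lower_bound {ι 𝒬 : Type} [DecidableEq ι] [Fintype ι] [Finite 𝒬] [Finite Ω]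
    (p : PMF Ω) (X : ι → 𝒬 → Ω → ℕ) (V : ℕ → Ω → β) (R : Finset ι) (hR : R.Nonempty) (K : ℕ)
    (P : Fin K → PMF (ι → 𝒬)) (m : ι → PMF 𝒬) [Fintype 𝒬]
    (hm : ∀ θ n, (P θ).map (fun q => q n) = m n) (c : ℝ)
    (hV : ∀ k < K, c ≤ entropy p (V (k + 1)) - entropy p (V k))
    (hdec : ∀ θ : Fin K, ∀ q ∈ (P θ).support,
      entropy p (fun ω => (fun n => if n ∈ R then X n (q n) ω else 0, V (θ + 1) ω)) ≤
        entropy p (fun ω => (fun n => if n ∈ R then X n (q n) ω else 0, V θ ω))) :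
    c * ∑ i ∈ Finset.range K, ((R.card : ℝ)⁻¹) ^ i ≤
      ∑ n ∈ R, ∑ a, (m n a).toReal * (entropy p (fun ω => (X n a ω, V 0 ω)) - entropy p (V 0)) := by
  set G : ℕ → ℝ := fun k => ∑ n ∈ R, ∑ a, (m n a).toReal *
    (entropy p (fun ω => (X n a ω, V k ω)) - entropy p (V k)) with hG
  have hM : (0 : ℝ) < R.card := by exact_mod_cast hR.card_pos
  -- User privacy enters here: G may be averaged over the joint queries for any θ, and θ changes
  -- along the recursion.
  have hmarg : ∀ (θ : Fin K) (n : ι) (g : 𝒬 → ℝ),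
      ∑ a, (m n a).toReal * g a = ∑ q, (P θ q).toReal * g (q n) := by
    intro θ n g
    rw [← hm θ n, sum_map_mul]
  have hG0 : ∀ k, 0 ≤ G k := fun k => Finset.sum_nonneg fun n _ => Finset.sum_nonneg fun a _ =>
    mul_nonneg ENNReal.toReal_nonneg (sub_nonneg.2 (entropy_mono p (by simp)))
  have hstep : ∀ k < K, c + (R.card : ℝ)⁻¹ * G (k + 1) ≤ G k := by
    intro k hk
    set θ : Fin K := ⟨k, hk⟩
    -- Conditional entropy of all answers of R to the queries for message k. Subadditivity gives h k
    -- ≤ G k; revealing message k, which the answers determine, lowers h by at least c; and h (k+1)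
    -- dominates each single answer, hence their average G (k+1) / #R.
    set h : ℕ → ℝ := fun j => ∑ q, (P θ q).toReal *
      (entropy p (fun ω => (fun n => if n ∈ R then X n (q n) ω else 0, V j ω)) -
        entropy p (V j)) with hh
    have h1 : h k ≤ G k := by
      simp only [hG, hh]
      rw [Finset.sum_congr rfl fun n _ => hmarg θ n _, Finset.sum_comm]
      refine Finset.sum_le_sum fun q _ => ?_
      rw [← Finset.mul_sum]
      exact mul_le_mul_of_nonneg_left
        (condEntropy_family_le p (fun n => X n (q n)) (V k) R) ENNReal.toReal_nonneg
    have h2 : G (k + 1) ≤ R.card * h (k + 1) := by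
      simp only [hG, hh]
      rw [Finset.sum_congr rfl fun n _ => hmarg θ n _, ← nsmul_eq_mul]
      refine Finset.sum_le_card_nsmul _ _ _ fun n hn => Finset.sum_le_sum fun q _ => ?_
      refine mul_le_mul_of_nonneg_left (sub_le_sub_right (entropy_mono p ?_) _)
        ENNReal.toReal_nonneg
      intro ω _ ω' _ heq
      simp only [Prod.mk.injEq, funext_iff] at heq ⊢
      exact ⟨by simpa [hn] using heq.1 n, heq.2⟩
    have h3 : c + h (k + 1) ≤ h k := by
      have : c = ∑ q, (P θ q).toReal * c := by
        rw [← Finset.sum_mul, sum_toReal_eq_one, one_mul]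
      rw [this]
      simp only [hh]
      rw [← Finset.sum_add_distrib]
      refine Finset.sum_le_sum fun q _ => ?_
      by_cases hq : P θ q = 0
      · simp [hq]
      rw [← mul_add]
      refine mul_le_mul_of_nonneg_left ?_ ENNReal.toReal_nonneg
      have e1 := hV k hk
      have e2 := hdec θ q hq
      change entropy p (fun ω => (fun n => if n ∈ R then X n (q n) ω else 0, V (k + 1) ω)) ≤
        entropy p (fun ω => (fun n => if n ∈ R then X n (q n) ω else 0, V k ω)) at e2
      linarith
    have h4 : (R.card : ℝ)⁻¹ * G (k + 1) ≤ h (k + 1) := by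
      rw [inv_mul_le_iff₀ hM]
      exact h2
    linarith
  have hind : ∀ k ≤ K, c * ∑ i ∈ Finset.range k, ((R.card : ℝ)⁻¹) ^ i +
      ((R.card : ℝ)⁻¹) ^ k * G k ≤ G 0 := by
    intro k
    induction k with
    | zero => simp
    | succ k ih =>
      intro hk
      refine le_trans ?_ (ih (by omega))
      have := mul_le_mul_of_nonneg_left (hstep k hk) (show 0 ≤ ((R.card : ℝ)⁻¹) ^ k by positivity)
      rw [Finset.sum_range_succ, pow_succ]
      linarith
  have h0 := hind K le_rfl
  have h5 : 0 ≤ ((R.card : ℝ)⁻¹) ^ K * G K := mul_nonneg (by positivity) (hG0 K)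
  linarith

end ConditionalEntropy

/-! ### Converse for a fixed set of N - 3B servers -/

namespace Scheme

variable {N K : ℕ} (s : Scheme N K)

instance : Finite s.Outcome :=
  Finite.of_injective (fun o : s.Outcome => (o.θ, o.W, o.S, o.Z, o.Q)) (by
    rintro ⟨⟩ ⟨⟩ h
    simpa using h)

/-- Joint law of the messages and of the contents of the servers. -/
def storageLaw : PMF ((Fin K → Fin s.L → s.Sym) × (Fin N → s.Sto)) :=
  (PMF.uniformOfFintype (Fin K → Fin s.L → s.Sym)).bind fun W => (s.storage W).map (Prod.mk W)

lemma law_map_storage [NeZero K] : s.law.map (fun o => (o.W, o.S)) = s.storageLaw := by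
  simp only [law, lawGiven, storageLaw, PMF.map_bind, PMF.pure_map, PMF.bind_const]
  rfl

lemma storageLaw_map_fst : s.storageLaw.map Prod.fst = PMF.uniformOfFintype _ := by
  simp only [storageLaw, PMF.map_bind, PMF.map_comp]
  have : ∀ W, (s.storage W).map (Prod.fst ∘ Prod.mk W) = PMF.pure W :=
    fun W => PMF.map_const (s.storage W) W
  simp only [this, PMF.bind_pure]

lemma mem_support_storageLaw {x : (Fin K → Fin s.L → s.Sym) × (Fin N → s.Sto)}
    (h : x ∈ s.storageLaw.support) : x.2 ∈ (s.storage x.1).support := by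
  simp only [storageLaw, PMF.mem_support_bind_iff, PMF.mem_support_map_iff] at h
  obtain ⟨W, -, S, hS, rfl⟩ := h
  exact hS

/-- The attack in which the servers `D` answer as if they stored `t` and had the masks `z`. -/
def replay (D : Finset (Fin N)) (t : Fin N → s.Sto) (z : Fin N → s.Mask) : s.Attack D where
  Γ := Unit
  plan := PMF.pure fun _ => ()
  respond n _ _ q _ := s.answer n (t n) q (z n)

lemma mem_support_attackLaw_replay {D : Finset (Fin N)} {t : Fin N → s.Sto} {z : Fin N → s.Mask}
    {θ : Fin K} {W S Q} (hS : S ∈ (s.storage W).support) (hz : z ∈ s.mask.support)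
    (hQ : Q ∈ (s.query θ).support) :
    ((⟨θ, W, S, z, Q⟩, fun _ => ()) : s.Outcome × (D → (s.replay D t z).Γ)) ∈
      (s.attackLaw (s.replay D t z) θ).support := by
  simp only [attackLaw, lawGiven, PMF.mem_support_bind_iff, PMF.mem_support_pure_iff]
  exact ⟨_, ⟨W, by simp, S, hS, z, hz, Q, hQ, rfl⟩, _, (PMF.mem_support_pure_iff _ _).2 rfl, rfl⟩

/-- Two worlds whose honest answers differ on at most `2 B` servers have the same desired
message. -/
lemma message_eq_of_answers_eq [NeZero K] {B : ℕ} (hv : s.IsValid B) {D₁ D₂ : Finset (Fin N)}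
    (h₁ : D₁.card ≤ B) (h₂ : D₂.card ≤ B) (hd : Disjoint D₁ D₂) {θ : Fin K} {W S W' S' z Q}
    (hS : S ∈ (s.storage W).support) (hS' : S' ∈ (s.storage W').support)
    (hz : z ∈ s.mask.support) (hQ : Q ∈ (s.query θ).support)
    (h : ∀ n, n ∉ D₁ → n ∉ D₂ → s.answer n (S n) (Q n) (z n) = s.answer n (S' n) (Q n) (z n)) :
    W θ = W' θ := by
  -- In the first world D₂ imitates the second, in the second world D₁ imitates the first. Both
  -- users receive the first world's answers on D₁, the second's on D₂ and the common ones
  -- elsewhere.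
  have e1 := hv.correct D₂ h₂ (s.replay D₂ S' z) θ _ (s.mem_support_attackLaw_replay hS hz hQ)
  have e2 := hv.correct D₁ h₁ (s.replay D₁ S z) θ _ (s.mem_support_attackLaw_replay hS' hz hQ)
  refine e1.symm.trans (Eq.trans ?_ e2)
  change s.decode θ Q _ = s.decode θ Q _
  congr 1
  funext n
  simp only [received, honestAnswer, replay]
  by_cases hn1 : n ∈ D₁
  · have hn2 : n ∉ D₂ := Finset.disjoint_left.1 hd hn1
    rw [dif_pos hn1, dif_neg hn2]
  · rw [dif_neg hn1]
    by_cases hn2 : n ∈ D₂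
    · rw [dif_pos hn2]
    · rw [dif_neg hn2]
      exact h n hn1 hn2

/-- Zero mutual information factors the joint law of (Q_n, θ); dividing by P(θ) = 1/K ≠ 0 gives the
conditional law. -/
lemma query_map_eq [NeZero K] {B : ℕ} (hv : s.IsValid B) (n : Fin N) (θ : Fin K) :
    (s.query θ).map (fun q => q n) = s.law.map (fun o => o.Q n) := by
  classical
  refine PMF.ext fun c => ?_
  rw [← ENNReal.toReal_eq_toReal_iff' (PMF.apply_ne_top _ _) (PMF.apply_ne_top _ _)]
  have h := map_prod_eq_mul_of_mutualInfo_eq_zero _ _ _ (hv.user_private n) c θ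
  have hθ : s.law.map (fun o => o.θ) = PMF.uniformOfFintype (Fin K) := by
    simp only [law, lawGiven, PMF.map_bind, PMF.pure_map, PMF.bind_const, PMF.bind_pure]
  have hj : s.law.map (fun o => (o.Q n, o.θ)) = (PMF.uniformOfFintype (Fin K)).bind fun θ =>
      ((s.query θ).map (fun q => q n)).map fun c => (c, θ) := by
    simp only [law, lawGiven, PMF.map_bind, PMF.pure_map, PMF.bind_const, PMF.map_comp]
    rfl
  have hc : ∀ θ', ((((s.query θ').map (fun q => q n)).map fun c => (c, θ')) (c, θ)).toReal =
      if θ' = θ then ((s.query θ).map (fun q => q n) c).toReal else 0 := by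
    intro θ'
    have := Fintype.ofFinite s.Qry
    rw [map_toReal]
    by_cases hθ' : θ' = θ
    · subst hθ'
      simp
    · simp [Ne.symm hθ', hθ']
  rw [hj, hθ, bind_toReal] at h
  simp only [hc, mul_ite, mul_zero, Finset.sum_ite_eq', Finset.mem_univ, if_true,
    PMF.uniformOfFintype_apply] at h
  rw [mul_comm] at h
  refine mul_right_cancel₀ ?_ h
  simp [NeZero.ne K]

/-- The contents of the servers `T`, together with the first `k` messages. -/
def sideInfo (T : Finset (Fin N)) (k : ℕ) (x : (Fin K → Fin s.L → s.Sym) × (Fin N → s.Sto)) :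
    (T → s.Sto) × (Fin K → Option (Fin s.L → s.Sym)) :=
  (fun n => x.2 n, fun j => if (j : ℕ) < k then some (x.1 j) else none)

lemma sideInfo_succ_eq_iff (T : Finset (Fin N)) (k : Fin K)
    (x y : (Fin K → Fin s.L → s.Sym) × (Fin N → s.Sto)) :
    s.sideInfo T (k + 1) x = s.sideInfo T (k + 1) y ↔
      x.1 k = y.1 k ∧ s.sideInfo T k x = s.sideInfo T k y := by
  simp only [sideInfo, Prod.mk.injEq]
  constructor
  · rintro ⟨h1, h2⟩
    refine ⟨by simpa using congrFun h2 k, h1, ?_⟩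
    funext j
    by_cases hj : (j : ℕ) < k
    · have := congrFun h2 j
      simpa [hj, show (j : ℕ) < k + 1 by omega] using this
    · simp [hj]
  · rintro ⟨h0, h1, h2⟩
    refine ⟨h1, ?_⟩
    funext j
    rcases lt_trichotomy (j : ℕ) k with hj | hj | hj
    · have := congrFun h2 j
      simpa [hj, show (j : ℕ) < k + 1 by omega] using this
    · obtain rfl : j = k := Fin.ext hj
      simp [h0]
    · simp [show ¬ (j : ℕ) < k + 1 by omega]

lemma log_card_message : Real.log (Fintype.card (Fin s.L → s.Sym)) =
    s.L * Real.log (Fintype.card s.Sym) := by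
  simp [Real.log_pow]

/-- Each message adds at most L log q, while storage security makes the K increments add up to
exactly K L log q. Hence no increment can be smaller. -/
lemma le_entropy_sideInfo_succ_sub [NeZero K] {B : ℕ} (hv : s.IsValid B) {T : Finset (Fin N)}
    (hT : T.card ≤ B) (k : ℕ) (hk : k < K) :
    s.L * Real.log (Fintype.card s.Sym) ≤
      entropy s.storageLaw (s.sideInfo T (k + 1)) - entropy s.storageLaw (s.sideInfo T k) := by
  classical
  set H : ℕ → ℝ := fun k => entropy s.storageLaw (s.sideInfo T k) with hH
  set c := s.L * Real.log (Fintype.card s.Sym) with hc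
  have hle : ∀ j ∈ Finset.range K, H (j + 1) - H j ≤ c := by
    intro j hj
    rw [Finset.mem_range] at hj
    have h1 : H (j + 1) = entropy s.storageLaw (fun x => (x.1 ⟨j, hj⟩, s.sideInfo T j x)) :=
      entropy_congr _ fun x _ y _ => (s.sideInfo_succ_eq_iff T ⟨j, hj⟩ x y).trans
        (iff_of_eq (Prod.mk.injEq _ _ _ _)).symm
    have h2 := entropy_pair_le s.storageLaw (fun x => x.1 ⟨j, hj⟩) (s.sideInfo T j)
    have h3 := entropy_le_log_card s.storageLaw (X := fun x => x.1 ⟨j, hj⟩)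
      (s := Finset.univ) (by simp)
    rw [Finset.card_univ, log_card_message] at h3
    rw [h1]
    change _ - entropy s.storageLaw (s.sideInfo T j) ≤ _
    linarith
  have hsum : ∑ j ∈ Finset.range K, (H (j + 1) - H j) = ∑ j ∈ Finset.range K, c := by
    rw [Finset.sum_range_sub]
    have hs := hv.storage_secure T hT
    rw [mutualInfo] at hs
    have e1 : entropy s.law (fun o => fun m : T => o.S m) = H 0 := by
      simp only [hH]
      rw [← law_map_storage, entropy_map]
      exact entropy_congr _ fun x _ y _ => by simp [sideInfo]
    have e2 : entropy s.law (fun o => (fun m : T => o.S m, o.W)) = H K := by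
      simp only [hH]
      rw [← law_map_storage, entropy_map]
      exact entropy_congr _ fun x _ y _ => by simp [sideInfo, funext_iff]
    have e3 : entropy s.law (fun o => o.W) = K * c := by
      rw [entropy_uniform s.law (fun o => o.W)]
      · rw [Fintype.card_fun, Nat.cast_pow, Real.log_pow, log_card_message, Fintype.card_fin]
      · rw [← storageLaw_map_fst, ← law_map_storage, PMF.map_comp]
        rfl
    rw [Finset.sum_const, Finset.card_range, nsmul_eq_mul]
    linarith
  exact ((Finset.sum_eq_sum_iff_of_le hle).1 hsum k (Finset.mem_range.2 hk)).ge

/-- The law is displayed as a mixture over mask and query, in the form needed to bound H(A_n) below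
by concavity. -/
lemma law_map_honestAnswer [NeZero K] {B : ℕ} (hv : s.IsValid B) (n : Fin N) :
    s.law.map (s.honestAnswer n) = (s.mask.bind fun z => (s.law.map fun o => o.Q n).bind fun a =>
      s.storageLaw.map fun x => s.answer n (x.2 n) a (z n)) := by
  have h : ∀ θ, (s.lawGiven θ).map (s.honestAnswer n) =
      (s.mask.bind fun z => (s.law.map fun o => o.Q n).bind fun a =>
        s.storageLaw.map fun x => s.answer n (x.2 n) a (z n)) := by
    intro θ
    rw [← s.query_map_eq hv n θ]
    simp only [lawGiven, storageLaw, PMF.map_bind, PMF.pure_map, PMF.map_comp, PMF.bind_map]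
    have e1 : ∀ W, ((s.storage W).bind fun S => s.mask.bind fun Z => (s.query θ).bind fun Q =>
        PMF.pure (s.honestAnswer n ⟨θ, W, S, Z, Q⟩)) = s.mask.bind fun Z => (s.query θ).bind
        fun Q => (s.storage W).map fun S => s.answer n (S n) (Q n) (Z n) := by
      intro W
      rw [PMF.bind_comm]
      congr 1
      funext Z
      rw [PMF.bind_comm]
      rfl
    simp only [e1]
    rw [PMF.bind_comm]
    congr 1
    funext Z
    rw [PMF.bind_comm]
    rfl
  calc s.law.map (s.honestAnswer n)
      = (PMF.uniformOfFintype (Fin K)).bind fun θ => (s.lawGiven θ).map (s.honestAnswer n) :=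
        PMF.map_bind _ _ _
    _ = _ := by simp only [h, PMF.bind_const]

lemma entropy_congr_map {Ω Ω' α : Type} {p : PMF Ω} {p' : PMF Ω'} {X : Ω → α} {X' : Ω' → α}
    (h : p.map X = p'.map X') : entropy p X = entropy p' X' := by
  rw [entropy, entropy, h]

/-- Any `N - 3 B` servers have to send at least as much as for private retrieval from `N - 3 B`
servers. -/
lemma le_sum_entropy_answers [NeZero K] {B : ℕ} (hv : s.IsValid B) (R : Finset (Fin N))
    (hR : R.Nonempty) (hcard : R.card + 3 * B = N) :
    s.L * Real.log (Fintype.card s.Sym) * ∑ i ∈ Finset.range K, ((R.card : ℝ)⁻¹) ^ i ≤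
      ∑ n ∈ R, entropy s.law (s.honestAnswer n) := by
  classical
  have := Fintype.ofFinite s.Qry
  have := Fintype.ofFinite s.Mask
  have hRc : Rᶜ.card = 3 * B := by
    rw [Finset.card_compl, Fintype.card_fin]
    omega
  -- The 3B servers outside R are cut into T, whose storage is given away as side information, and
  -- the two replaying sets D₁ and (Rᶜ \ T) \ D₁.
  obtain ⟨T, hTR, hT⟩ := Finset.exists_subset_card_eq (s := Rᶜ) (n := B) (by omega)
  have hRT : (Rᶜ \ T).card = 2 * B := by
    rw [Finset.card_sdiff_of_subset hTR]
    omega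
  obtain ⟨D₁, hD₁R, hD₁⟩ := Finset.exists_subset_card_eq (s := Rᶜ \ T) (n := B) (by omega)
  have hD₂ : ((Rᶜ \ T) \ D₁).card = B := by
    rw [Finset.card_sdiff_of_subset hD₁R]
    omega
  set m : Fin N → PMF s.Qry := fun n => s.law.map fun o => o.Q n
  set X : (Fin N → s.Mask) → Fin N → s.Qry →
    (Fin K → Fin s.L → s.Sym) × (Fin N → s.Sto) → ℕ :=
      fun z n a x => s.answer n (x.2 n) a (z n) with hX
  have hz : ∀ z ∈ s.mask.support,
      s.L * Real.log (Fintype.card s.Sym) * ∑ i ∈ Finset.range K, ((R.card : ℝ)⁻¹) ^ i ≤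
      ∑ n ∈ R, ∑ a, (m n a).toReal * entropy s.storageLaw (X z n a) := by
    intro z hz
    refine (geometric_lower_bound s.storageLaw (X z) (s.sideInfo T) R hR K s.query m
      (fun θ n => s.query_map_eq hv n θ) _
      (fun k hk => s.le_entropy_sideInfo_succ_sub hv hT.le k hk) ?_).trans ?_
    · intro θ q hq
      refine entropy_mono _ fun x hx y hy hxy => ?_
      simp only [Prod.mk.injEq] at hxy ⊢
      refine ⟨hxy.1, (s.sideInfo_succ_eq_iff T θ x y).2 ⟨?_, hxy.2⟩⟩
      refine s.message_eq_of_answers_eq hv hD₁.le hD₂.le Finset.disjoint_sdiff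
        (s.mem_support_storageLaw hx) (s.mem_support_storageLaw hy) hz hq fun n hn1 hn2 => ?_
      by_cases hnR : n ∈ R
      · simpa [hnR] using congrFun hxy.1 n
      · have hnT : n ∈ T := by
          by_contra hnT
          exact hn2 (by simp [hnR, hnT, hn1])
        have := congrFun (congrArg Prod.fst hxy.2) ⟨n, hnT⟩
        simp only [sideInfo] at this
        rw [this]
    · refine Finset.sum_le_sum fun n _ => Finset.sum_le_sum fun a _ =>
        mul_le_mul_of_nonneg_left ?_ ENNReal.toReal_nonneg
      -- Dropping the conditioning on S_T only increases the entropy of an answer.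
      have := entropy_pair_le s.storageLaw (X z n a) (s.sideInfo T 0)
      linarith
  have hconc : ∀ n, ∑ z, (s.mask z).toReal *
      ∑ a, (m n a).toReal * entropy s.storageLaw (X z n a) ≤ entropy s.law (s.honestAnswer n) := by
    intro n
    have hlaw := s.law_map_honestAnswer hv n
    -- Concavity is stated for mixtures on a finite sample space, so the mixture is lifted from ℕ to
    -- triples (mask, query, storage).
    have e : entropy s.law (s.honestAnswer n) =
        entropy (s.mask.bind fun z => (m n).bind fun a => s.storageLaw.map fun x => (z n, a, x.2 n))
          (fun t => s.answer n t.2.2 t.2.1 t.1) := by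
      refine entropy_congr_map (hlaw.trans ?_)
      simp only [PMF.map_bind, PMF.map_comp]
      rfl
    rw [e]
    refine le_trans ?_ (sum_mul_entropy_le_entropy_bind _ _ _)
    refine Finset.sum_le_sum fun z _ => mul_le_mul_of_nonneg_left ?_ ENNReal.toReal_nonneg
    refine le_trans (Finset.sum_le_sum fun a _ => ?_) (sum_mul_entropy_le_entropy_bind _ _ _)
    rw [entropy_map]
    rfl
  have hone : ∑ z, (s.mask z).toReal = 1 := sum_toReal_eq_one _
  calc s.L * Real.log (Fintype.card s.Sym) * ∑ i ∈ Finset.range K, ((R.card : ℝ)⁻¹) ^ i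
      = ∑ z, (s.mask z).toReal *
        (s.L * Real.log (Fintype.card s.Sym) * ∑ i ∈ Finset.range K, ((R.card : ℝ)⁻¹) ^ i) := by
        rw [← Finset.sum_mul, hone, one_mul]
    _ ≤ ∑ z, (s.mask z).toReal *
        ∑ n ∈ R, ∑ a, (m n a).toReal * entropy s.storageLaw (X z n a) := by
        refine Finset.sum_le_sum fun z _ => ?_
        by_cases h : s.mask z = 0
        · simp [h]
        · exact mul_le_mul_of_nonneg_left (hz z h) ENNReal.toReal_nonneg
    _ = ∑ n ∈ R, ∑ z, (s.mask z).toReal *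
        ∑ a, (m n a).toReal * entropy s.storageLaw (X z n a) := by
        simp only [Finset.mul_sum]
        rw [Finset.sum_comm]
    _ ≤ _ := Finset.sum_le_sum fun n _ => hconc n

end Scheme

/-! ### Averaging over server sets and the upper bound on the rate -/

/-- A lower bound for the sums over all sets of `M` indices gives one for the whole sum. -/
lemma card_mul_le_of_forall_card_eq {N M : ℕ} (hM : M ≤ N) (hM0 : 0 < M) (f : Fin N → ℝ) (c : ℝ)
    (h : ∀ R : Finset (Fin N), R.card = M → c ≤ ∑ n ∈ R, f n) : N * c ≤ M * ∑ n, f n := by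
  have : NeZero N := ⟨by omega⟩
  have hinj : Function.Injective (Fin.castLE hM) := Fin.castLE_injective hM
  -- The N cyclic windows of length M suffice: each index lies in exactly M of them.
  have h1 : ∀ j : Fin N, c ≤ ∑ i : Fin M, f (Fin.castLE hM i + j) := by
    intro j
    have := h (Finset.univ.map ⟨fun i : Fin M => Fin.castLE hM i + j,
      fun a b hab => hinj (add_right_cancel hab)⟩) (by simp)
    rwa [Finset.sum_map] at this
  have h2 := Finset.sum_le_sum fun j (_ : j ∈ Finset.univ) => h1 j
  rw [Finset.sum_comm, Finset.sum_const, Finset.card_univ, Fintype.card_fin, nsmul_eq_mul] at h2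
  refine h2.trans_eq ?_
  have h3 : ∀ i : Fin M, ∑ j, f (Fin.castLE hM i + j) = ∑ n, f n := fun i =>
    Equiv.sum_comp (Equiv.addLeft (Fin.castLE hM i)) f
  simp [h3]

lemma Scheme.rate_le {N K B : ℕ} [NeZero K] (s : Scheme N K) (hv : s.IsValid B)
    (hN : 3 * B + 1 ≤ N) :
    s.rate ≤ ENNReal.ofReal
      (((N - 3 * B : ℕ) / N : ℝ) / ∑ i ∈ Finset.range K, (((N - 3 * B : ℕ) : ℝ)⁻¹) ^ i) := by
  set M := N - 3 * B with hM
  have hlog : 0 < Real.log (Fintype.card s.Sym) :=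
    Real.log_pos (by exact_mod_cast Fintype.one_lt_card)
  have hg : 0 < ∑ i ∈ Finset.range K, ((M : ℝ)⁻¹) ^ i := by
    have hM0 : (0 : ℝ) < M := by
      exact_mod_cast (by omega : 0 < M)
    refine Finset.sum_pos (fun i _ => by positivity) ?_
    simpa using NeZero.ne K
  set g := ∑ i ∈ Finset.range K, ((M : ℝ)⁻¹) ^ i
  have hM0 : (0 : ℝ) < M := by exact_mod_cast (by omega : 0 < M)
  have hN0 : (0 : ℝ) < N := by exact_mod_cast (by omega : 0 < N)
  have hL : (0 : ℝ) < s.L := by exact_mod_cast s.L_pos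
  have h := card_mul_le_of_forall_card_eq (N := N) (M := M) (by omega) (by omega)
    (fun n => entropy s.law (s.honestAnswer n)) (s.L * Real.log (Fintype.card s.Sym) * g)
    (fun R hR => by
      have := s.le_sum_entropy_answers hv R (Finset.card_pos.1 (by omega)) (by omega)
      rwa [hR] at this)
  set E := ∑ n, entropy s.law (s.honestAnswer n)
  have hE : s.L / (M / N / g) ≤ E / Real.log (Fintype.card s.Sym) := by
    rw [div_le_div_iff₀ (by positivity) hlog]
    have : E * (M / N / g) = (M * E) / (N * g) := by field_simp
    rw [this, le_div_iff₀ (by positivity)]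
    linarith
  -- By `hE` the total download is positive, so the quotient in ℝ≥0∞ is the real one and not ∞.
  rw [rate, ← ENNReal.ofReal_natCast,
    ← ENNReal.ofReal_div_of_pos ((show 0 < s.L / (M / N / g) by positivity).trans_le hE)]
  refine ENNReal.ofReal_le_ofReal ?_
  rw [div_le_iff₀ ((show 0 < s.L / (M / N / g) by positivity).trans_le hE)]
  rwa [div_le_iff₀' (by positivity)] at hE


/-! ### Independence from symmetries of the randomness -/

section Independence

variable {Ω Ω' α β ξ M : Type}

lemma mutualInfo_map (p : PMF Ω) (g : Ω → Ω') (X : Ω' → α) (Y : Ω' → β) :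
    mutualInfo (p.map g) X Y = mutualInfo p (X ∘ g) (Y ∘ g) := by
  simp only [mutualInfo, entropy_map]
  rfl

lemma map_congr_support (p : PMF Ω) {f g : Ω → α} (h : ∀ ω ∈ p.support, f ω = g ω) :
    p.map f = p.map g := by
  refine PMF.ext fun x => ?_
  rw [PMF.map_apply, PMF.map_apply]
  refine tsum_congr fun ω => ?_
  by_cases hω : p ω = 0
  · simp [hω]
  · rw [h ω hω]

/-- If the law of `V` given the message does not change under permutations of the messages that
move the value `x` of `Y` arbitrarily, then `V` and `Y` are independent. -/
lemma mutualInfo_eq_zero_of_equiv [Finite Ω] [Finite ξ] [Fintype M] [Nonempty M]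
    (κ : M → PMF Ω) (V : Ω → α) (Y : Ω → ξ) (x : M → ξ)
    (hx : ∀ W, ∀ ω ∈ (κ W).support, Y ω = x W) (e : ξ → ξ → M ≃ M)
    (he : ∀ y y' W, x (e y y' W) = y' ↔ x W = y)
    (hV : ∀ y y' W, (κ (e y y' W)).map V = (κ W).map V) :
    mutualInfo ((PMF.uniformOfFintype M).bind κ) V Y = 0 := by
  classical
  have := Fintype.ofFinite Ω
  refine mutualInfo_eq_zero_of_const _ _ _ fun v y y' => ?_
  have h : ∀ W y, (κ W).map (fun ω => (V ω, Y ω)) (v, y) =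
      if x W = y then (κ W).map V v else 0 := by
    intro W y
    rw [map_congr_support (κ W) (g := fun ω => (V ω, x W)) fun ω hω => by rw [hx W ω hω],
      PMF.map_apply]
    by_cases hy : x W = y
    · subst hy
      simp [PMF.map_apply]
    · simp [hy, Ne.symm hy]
  simp only [PMF.map_bind, PMF.bind_apply, h, PMF.uniformOfFintype_apply]
  rw [← (e y' y).tsum_eq]
  refine tsum_congr fun W => ?_
  rw [hV]
  congr 1
  exact if_congr (he y' y W) rfl rfl

lemma mutualInfo_eq_zero_of_forall_eq [Finite Ω] [Fintype M] [Nonempty M]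
    (κ : M → PMF Ω) (V : Ω → α) (Y : Ω → M) (hx : ∀ W, ∀ ω ∈ (κ W).support, Y ω = W)
    (hV : ∀ W W', (κ W).map V = (κ W').map V) :
    mutualInfo ((PMF.uniformOfFintype M).bind κ) V Y = 0 := by
  classical
  refine mutualInfo_eq_zero_of_equiv κ V Y id hx Equiv.swap (fun y y' W => ?_) fun _ _ _ => hV _ _
  rw [id, id, Equiv.swap_apply_eq_iff, Equiv.swap_apply_right]

lemma uniform_bind_add {G : Type} [AddGroup G] [Fintype G] (c : G) (F : G → PMF α) :
    ((PMF.uniformOfFintype G).bind fun g => F (g + c)) = (PMF.uniformOfFintype G).bind F := by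
  refine PMF.ext fun a => ?_
  simp only [PMF.bind_apply, PMF.uniformOfFintype_apply]
  exact (Equiv.addRight c).tsum_eq (fun g => (Fintype.card G : ℝ≥0∞)⁻¹ * F g a)

/-- Used to draw the query noise and the Byzantine plan before the storage noise and the mask. -/
lemma bind_bind_comm {δ ε ζ : Type} (p : PMF α) (q : PMF β) (r : PMF δ) (t : PMF ε)
    (f : α → β → δ → ε → PMF ζ) :
    (p.bind fun a => q.bind fun b => r.bind fun c => t.bind fun d => f a b c d) =
      r.bind fun c => t.bind fun d => p.bind fun a => q.bind fun b => f a b c d := by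
  have e : ∀ a, (q.bind fun b => r.bind fun c => t.bind fun d => f a b c d) =
      r.bind fun c => t.bind fun d => q.bind fun b => f a b c d := fun a => by
    rw [PMF.bind_comm]
    congr 1
    funext c
    rw [PMF.bind_comm]
  simp only [e]
  rw [PMF.bind_comm]
  congr 1
  funext c
  rw [PMF.bind_comm]

end Independence

/-- The elements of a finite type as natural numbers. -/
def label {α : Type} [Fintype α] (x : α) : ℕ := Fintype.equivFin α x

lemma label_injective {α : Type} [Fintype α] : Function.Injective (label : α → ℕ) := fun _ _ h =>
  (Fintype.equivFin α).injective (Fin.ext h)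

/-! ### The cross-subspace alignment scheme -/

section CrossSubspaceAlignment

open Polynomial

variable {F : Type} [Field F] {N B ℓ K : ℕ}

instance finite_degreeLT [Finite F] (k : ℕ) : Finite (degreeLT F k) :=
  Finite.of_equiv _ (degreeLTEquiv F k).symm.toEquiv

instance fintypeDegreeLT [Finite F] (k : ℕ) : Fintype (degreeLT F k) := Fintype.ofFinite _

variable (pts : Fin N ⊕ Fin ℓ ↪ F)

/-- The storage: every message symbol is shared with a polynomial of degree at most `B`, whose
value at the point of the symbol is the symbol itself. -/
def shares (W : Fin K → Fin ℓ → F) (R : Fin ℓ → Fin K → degreeLT F B) (n : Fin N) (j : Fin ℓ)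
    (k : Fin K) : F :=
  W k j + (pts (.inr j) - pts (.inl n)) * (R j k : F[X]).eval (pts (.inl n))

/-- The queries: a unit vector, scaled and blinded. -/
def queries (θ : Fin K) (Z : Fin ℓ → Fin K → F) (n : Fin N) (j : Fin ℓ) (k : Fin K) : F :=
  (if k = θ then (pts (.inr j) - pts (.inl n))⁻¹ else 0) + Z j k

/-- The masks: values of a polynomial at the points of the servers. -/
def masks (M : degreeLT F (B + 1)) (n : Fin N) : F := (M : F[X]).eval (pts (.inl n))

/-- Rational functions with simple poles at the points of the symbols, evaluated at the points of
the servers. -/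
def codeword (w : Fin ℓ → F) (P : F[X]) (n : Fin N) : F :=
  ∑ j, w j * (pts (.inr j) - pts (.inl n))⁻¹ + P.eval (pts (.inl n))

/-- The part of the answers that carries no desired symbol. -/
def interference (W : Fin K → Fin ℓ → F) (R : Fin ℓ → Fin K → degreeLT F B)
    (Z : Fin ℓ → Fin K → F) (θ : Fin K) : F[X] :=
  ∑ j, (R j θ : F[X]) + ∑ j, ∑ k, C (W k j * Z j k) +
    ∑ j, ∑ k, (C (pts (.inr j)) - X) * (R j k : F[X]) * C (Z j k)

/-- The storage noise has degree below B and meets at most one linear factor, so all interference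
shares a space of dimension B + 1, however large K is. -/
lemma interference_mem (W : Fin K → Fin ℓ → F) (R : Fin ℓ → Fin K → degreeLT F B)
    (Z : Fin ℓ → Fin K → F) (θ : Fin K) : interference pts W R Z θ ∈ degreeLT F (B + 1) := by
  refine add_mem (add_mem ?_ ?_) ?_
  · exact sum_mem fun j _ => degreeLT_mono (Nat.le_succ B) (R j θ).2
  · refine sum_mem fun j _ => sum_mem fun k _ => mem_degreeLT.2 ?_
    exact degree_C_le.trans_lt (by exact_mod_cast Nat.succ_pos B)
  · refine sum_mem fun j _ => sum_mem fun k _ => ?_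
    rw [mul_comm, ← smul_eq_C_mul]
    refine Submodule.smul_mem _ _ (mem_degreeLT.2 ?_)
    have h1 := mem_degreeLT.1 (R j k).2
    by_cases h0 : (R j k : F[X]) = 0
    · rw [h0, mul_zero, degree_zero]
      exact WithBot.bot_lt_coe _
    · have h2 : (C (pts (.inr j)) - X : F[X]).degree ≤ 1 :=
        (degree_sub_le _ _).trans (max_le (degree_C_le.trans zero_le_one) degree_X_le)
      rw [degree_eq_natDegree h0] at h1
      refine (degree_mul_le _ _).trans_lt ((add_le_add_left h2 _).trans_lt ?_)
      rw [degree_eq_natDegree h0]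
      have h3 : (R j k : F[X]).natDegree < B := by exact_mod_cast h1
      exact_mod_cast (by omega : 1 + (R j k : F[X]).natDegree < B + 1)

lemma sub_ne_zero_of_points (j : Fin ℓ) (n : Fin N) : pts (.inr j) - pts (.inl n) ≠ 0 :=
  sub_ne_zero.2 fun h => by simpa using pts.injective h

/-- The interference is aligned. -/
lemma sum_shares_mul_queries (W : Fin K → Fin ℓ → F) (R : Fin ℓ → Fin K → degreeLT F B)
    (Z : Fin ℓ → Fin K → F) (θ : Fin K) (n : Fin N) :
    ∑ j, ∑ k, shares pts W R n j k * queries pts θ Z n j k =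
      codeword pts (W θ) (interference pts W R Z θ) n := by
  simp only [codeword, interference, eval_add, eval_finsetSum, eval_mul, eval_C, eval_sub, eval_X]
  have h : ∀ j k, shares pts W R n j k * queries pts θ Z n j k =
      (if k = θ then W k j * (pts (.inr j) - pts (.inl n))⁻¹ +
        (R j k : F[X]).eval (pts (.inl n)) else 0) + (W k j * Z j k +
      (pts (.inr j) - pts (.inl n)) * (R j k : F[X]).eval (pts (.inl n)) * Z j k) := by
    intro j k
    have := sub_ne_zero_of_points pts j n
    rw [shares, queries]
    split_ifs
    · field_simp
    · ring
  simp only [h, Finset.sum_add_distrib, Finset.sum_ite_eq', Finset.mem_univ, if_true]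
  ring

/-- The code has minimum distance greater than `2 B`. -/
lemma codeword_unique (hN : ℓ + B + 1 + 2 * B ≤ N) {w w' : Fin ℓ → F} {P P' : F[X]}
    (hP : P ∈ degreeLT F (B + 1)) (hP' : P' ∈ degreeLT F (B + 1)) {D D' : Finset (Fin N)}
    (hD : D.card ≤ B) (hD' : D'.card ≤ B)
    (h : ∀ n, n ∉ D → n ∉ D' → codeword pts w P n = codeword pts w' P' n) : w = w' := by
  classical
  set E : Fin ℓ → F[X] := fun j => ∏ i ∈ Finset.univ.erase j, (C (pts (.inr i)) - X) with hE
  set T : F[X] := ∏ i, (C (pts (.inr i)) - X) with hT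
  -- The difference of the two rational functions with denominators cleared: degree below ℓ + B + 1,
  -- but zeros at no fewer than N - 2B server points. Once G = 0, its value at the j-th symbol point
  -- isolates w j - w' j.
  set G : F[X] := ∑ j, C (w j - w' j) * E j + T * (P - P') with hG
  have hXd : ∀ c : F, (C c - X : F[X]).degree = 1 := fun c => by
    rw [← neg_sub, degree_neg, degree_X_sub_C]
  have hTE : ∀ j, T = (C (pts (.inr j)) - X) * E j := fun j =>
    (Finset.mul_prod_erase _ _ (Finset.mem_univ j)).symm
  have hTd : T.degree = ℓ := by
    rw [hT, degree_prod, Finset.sum_congr rfl fun i _ => hXd _]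
    simp
  have hEd : ∀ j, (E j).degree < (ℓ + B + 1 : ℕ) := by
    intro j
    rw [hE]
    simp only [degree_prod, hXd]
    rw [Finset.sum_const, Finset.card_erase_of_mem (Finset.mem_univ _), Finset.card_univ,
      Fintype.card_fin, nsmul_one]
    exact_mod_cast (by omega : ℓ - 1 < ℓ + B + 1)
  have hGd : G.degree < (ℓ + B + 1 : ℕ) := by
    rw [← mem_degreeLT]
    refine add_mem (sum_mem fun j _ => ?_) ?_
    · rw [← smul_eq_C_mul]
      exact Submodule.smul_mem _ _ (mem_degreeLT.2 (hEd j))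
    · have hd := mem_degreeLT.1 (sub_mem hP hP')
      rw [mem_degreeLT]
      by_cases h0 : P - P' = 0
      · rw [h0, mul_zero, degree_zero]
        exact WithBot.bot_lt_coe _
      · rw [degree_mul, hTd, degree_eq_natDegree h0]
        rw [degree_eq_natDegree h0] at hd
        have h3 : (P - P').natDegree < B + 1 := by exact_mod_cast hd
        exact_mod_cast (by omega : ℓ + (P - P').natDegree < ℓ + B + 1)
  have hGz : ∀ n, n ∉ D → n ∉ D' → G.eval (pts (.inl n)) = 0 := by
    intro n hn hn'
    have h1 := h n hn hn'
    simp only [codeword] at h1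
    have h2 : ∑ j, (w j - w' j) * (pts (.inr j) - pts (.inl n))⁻¹ +
        (P - P').eval (pts (.inl n)) = 0 := by
      simp only [sub_mul, Finset.sum_sub_distrib, eval_sub]
      linear_combination h1
    have h3 : ∀ j, (E j).eval (pts (.inl n)) =
        T.eval (pts (.inl n)) * (pts (.inr j) - pts (.inl n))⁻¹ := by
      intro j
      rw [hTE j, eval_mul, eval_sub, eval_C, eval_X]
      have := sub_ne_zero_of_points pts j n
      field_simp
    simp only [hG, eval_add, eval_finsetSum, eval_mul, eval_C, h3]
    calc _ = T.eval (pts (.inl n)) * (∑ j, (w j - w' j) * (pts (.inr j) - pts (.inl n))⁻¹ +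
        (P - P').eval (pts (.inl n))) := by
          rw [mul_add, Finset.mul_sum]
          congr 1
          exact Finset.sum_congr rfl fun j _ => by ring
      _ = 0 := by rw [h2, mul_zero]
  have hG0 : G = 0 := by
    refine eq_zero_of_degree_lt_of_eval_finset_eq_zero
      ((Finset.univ \ (D ∪ D')).map (Function.Embedding.inl.trans pts)) ?_ ?_
    · refine hGd.trans_le ?_
      rw [Finset.card_map]
      have h1 := Finset.le_card_sdiff (D ∪ D') (Finset.univ : Finset (Fin N))
      have h2 := Finset.card_union_le D D'
      rw [Finset.card_univ, Fintype.card_fin] at h1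
      exact_mod_cast (by omega : ℓ + B + 1 ≤ (Finset.univ \ (D ∪ D')).card)
    · intro x hx
      simp only [Finset.mem_map, Finset.mem_sdiff, Finset.mem_union, not_or] at hx
      obtain ⟨n, ⟨-, hn, hn'⟩, rfl⟩ := hx
      exact hGz n hn hn'
  funext j
  have h1 : G.eval (pts (.inr j)) = 0 := by rw [hG0, eval_zero]
  have h2 : ∀ i, i ≠ j → (E i).eval (pts (.inr j)) = 0 := by
    intro i hi
    rw [hE]
    simp only [eval_prod, eval_sub, eval_C, eval_X]
    exact Finset.prod_eq_zero (Finset.mem_erase.2 ⟨hi.symm, Finset.mem_univ j⟩) (sub_self _)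
  have h3 : (E j).eval (pts (.inr j)) ≠ 0 := by
    rw [hE]
    simp only [eval_prod, eval_sub, eval_C, eval_X]
    refine Finset.prod_ne_zero_iff.2 fun i hi => sub_ne_zero.2 fun heq => ?_
    exact (Finset.mem_erase.1 hi).1 (by simpa using pts.injective heq)
  simp only [hG, eval_add, eval_finsetSum, eval_mul, eval_C] at h1
  rw [Finset.sum_eq_single j (fun i _ hi => by rw [h2 i hi, mul_zero]) (by simp), hTE j, eval_mul,
    eval_sub, eval_C, eval_X, sub_self, zero_mul, zero_mul, add_zero, mul_eq_zero,
    or_iff_left h3, sub_eq_zero] at h1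
  exact h1

/-- Any `B` shares are compatible with all messages. -/
lemma exists_shares_eq (W W' : Fin K → Fin ℓ → F) (D : Finset (Fin N)) (hD : D.card ≤ B) :
    ∃ R₀ : Fin ℓ → Fin K → degreeLT F B, ∀ R, ∀ n ∈ D,
      shares pts W' (R + R₀) n = shares pts W R n := by
  have hinj : Set.InjOn (fun n : Fin N => pts (.inl n)) (D : Set (Fin N)) :=
    fun a _ b _ hab => by simpa using pts.injective hab
  -- The change of noise that compensates W' - W at server n. Interpolation through at most B points
  -- keeps the degree below B.
  set r : Fin ℓ → Fin K → Fin N → F := fun j k n =>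
    (W k j - W' k j) * (pts (.inr j) - pts (.inl n))⁻¹
  refine ⟨fun j k => ⟨Lagrange.interpolate D (fun n => pts (.inl n)) (r j k), mem_degreeLT.2
    ((Lagrange.degree_interpolate_lt _ hinj).trans_le (by exact_mod_cast hD))⟩, ?_⟩
  intro R n hn
  funext j k
  have h := sub_ne_zero_of_points pts j n
  simp only [shares, Pi.add_apply, Submodule.coe_add, eval_add,
    Lagrange.eval_interpolate_at_node (r j k) hinj hn, r]
  field_simp
  ring

variable [Fintype F]

lemma shares_map_restrict_eq (W W' : Fin K → Fin ℓ → F) (D : Finset (Fin N)) (hD : D.card ≤ B) :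
    (PMF.map (shares pts W) (PMF.uniformOfFintype (Fin ℓ → Fin K → degreeLT F B))).map
      (fun S (m : D) => S m) =
    (PMF.map (shares pts W') (PMF.uniformOfFintype (Fin ℓ → Fin K → degreeLT F B))).map
      (fun S (m : D) => S m) := by
  obtain ⟨R₀, hR₀⟩ := exists_shares_eq pts W W' D hD
  rw [PMF.map_comp, PMF.map_comp, ← PMF.bind_pure_comp, ← PMF.bind_pure_comp]
  refine Eq.trans ?_ (uniform_bind_add R₀ _)
  congr 1
  funext R
  exact congrArg PMF.pure (funext fun n => (hR₀ R n n.2).symm)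

/-- The noise is a one-time pad: shifting it by the difference of the two scaled unit vectors turns
one query into the other. The shift depends on n, so this covers a single server only. -/
lemma queries_map_eq (n : Fin N) (θ θ' : Fin K) :
    (PMF.map (queries pts θ) (PMF.uniformOfFintype (Fin ℓ → Fin K → F))).map (fun Q => Q n) =
    (PMF.map (queries pts θ') (PMF.uniformOfFintype (Fin ℓ → Fin K → F))).map (fun Q => Q n) := by
  rw [PMF.map_comp, PMF.map_comp, ← PMF.bind_pure_comp, ← PMF.bind_pure_comp]
  refine Eq.trans ?_ (uniform_bind_add (fun j k =>
    (if k = θ then (pts (.inr j) - pts (.inl n))⁻¹ else 0) -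
      (if k = θ' then (pts (.inr j) - pts (.inl n))⁻¹ else 0)) _)
  congr 1
  funext Z
  refine congrArg PMF.pure ?_
  funext j k
  simp only [Function.comp_apply, queries, Pi.add_apply]
  ring

/-- `a` is obtained from the codeword of `w` by changing at most `B` symbols. -/
def IsNear (B : ℕ) (a : Fin N → ℕ) (w : Fin ℓ → F) : Prop :=
  ∃ P ∈ degreeLT F (B + 1), ∃ D : Finset (Fin N), D.card ≤ B ∧
    ∀ n, n ∉ D → a n = label (codeword pts w P n)

open Classical in
/-- Cross-subspace alignment, with a masked answer and with decoding of up to `B` errors. -/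
def alignmentScheme (B K : ℕ) (hℓ : 0 < ℓ) : Scheme N K where
  Sym := F
  L := ℓ
  L_pos := hℓ
  Sto := Fin ℓ → Fin K → F
  Mask := F
  Qry := Fin ℓ → Fin K → F
  storage W := (PMF.uniformOfFintype (Fin ℓ → Fin K → degreeLT F B)).map (shares pts W)
  mask := (PMF.uniformOfFintype (degreeLT F (B + 1))).map (masks pts)
  query θ := (PMF.uniformOfFintype (Fin ℓ → Fin K → F)).map (queries pts θ)
  answer _ S Q z := label (∑ j, ∑ k, S j k * Q j k + z)
  -- For ℓ + 3B + 1 ≤ N the chosen word is the only candidate, and with at most B wrong answers the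
  -- default 0 is never reached.
  decode _ _ a := if h : ∃ w, IsNear pts B a w then h.choose else 0

variable (hℓ : 0 < ℓ)

/-- The outcome as a function of the underlying independent uniform variables. -/
def alignmentOutcome (θ : Fin K) (W : Fin K → Fin ℓ → F) (R : Fin ℓ → Fin K → degreeLT F B)
    (M : degreeLT F (B + 1)) (Z : Fin ℓ → Fin K → F) : (alignmentScheme pts B K hℓ).Outcome where
  θ := θ
  W := W
  S := shares pts W R
  Z := (masks pts M : Fin N → F)
  Q := queries pts θ Z

/-- The law of the outcome under an attack, given the messages. -/
def alignmentKernel {D : Finset (Fin N)} (a : (alignmentScheme pts B K hℓ).Attack D) (θ : Fin K)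
    (W : Fin K → Fin ℓ → F) : PMF ((alignmentScheme pts B K hℓ).Outcome × (D → a.Γ)) :=
  -- The mask is drawn last so that its translation may depend on the query noise and the storage
  -- noise.
  (PMF.uniformOfFintype (Fin ℓ → Fin K → F)).bind fun Z => a.plan.bind fun γ =>
    (PMF.uniformOfFintype (Fin ℓ → Fin K → degreeLT F B)).bind fun R =>
      (PMF.uniformOfFintype (degreeLT F (B + 1))).map fun M =>
        (alignmentOutcome pts hℓ θ W R M Z, γ)

lemma attackLaw_eq {D : Finset (Fin N)} (a : (alignmentScheme pts B K hℓ).Attack D) (θ : Fin K) :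
    (alignmentScheme pts B K hℓ).attackLaw a θ =
      (PMF.uniformOfFintype (Fin K → Fin ℓ → F)).bind (alignmentKernel pts hℓ a θ) := by
  rw [Scheme.attackLaw, Scheme.lawGiven, PMF.bind_bind]
  congr 1
  funext W
  refine Eq.trans ?_ (bind_bind_comm (PMF.uniformOfFintype (Fin ℓ → Fin K → degreeLT F B))
    (PMF.uniformOfFintype (degreeLT F (B + 1))) (PMF.uniformOfFintype (Fin ℓ → Fin K → F)) a.plan
    fun R M Z γ => PMF.pure (alignmentOutcome pts hℓ θ W R M Z, γ))
  simp only [alignmentScheme, PMF.bind_bind, PMF.bind_map, PMF.pure_bind, Function.comp_def]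
  rfl

lemma exists_of_mem_support_alignmentKernel {D : Finset (Fin N)}
    (a : (alignmentScheme pts B K hℓ).Attack D) (θ : Fin K) (W : Fin K → Fin ℓ → F) {x}
    (hx : x ∈ (alignmentKernel pts hℓ a θ W).support) :
    ∃ R M Z γ, x = (alignmentOutcome pts hℓ θ W R M Z, γ) := by
  simp only [alignmentKernel, PMF.mem_support_bind_iff, PMF.mem_support_map_iff] at hx
  obtain ⟨Z, -, γ, -, R, -, M, -, rfl⟩ := hx
  exact ⟨R, M, Z, γ, rfl⟩

/-- If a translation of the randomness takes the views of one tuple of messages to those of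
another, then the views have the same law. -/
lemma alignmentKernel_map_eq {α : Type} {D : Finset (Fin N)}
    (a : (alignmentScheme pts B K hℓ).Attack D) (θ : Fin K) (W W' : Fin K → Fin ℓ → F)
    (V : (alignmentScheme pts B K hℓ).Outcome × (D → a.Γ) → α)
    (R₀ : Fin ℓ → Fin K → degreeLT F B)
    (M₀ : (Fin ℓ → Fin K → F) → (Fin ℓ → Fin K → degreeLT F B) → degreeLT F (B + 1))
    (h : ∀ R M Z γ, V (alignmentOutcome pts hℓ θ W R M Z, γ) =
      V (alignmentOutcome pts hℓ θ W' (R + R₀) (M + M₀ Z R) Z, γ)) :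
    (alignmentKernel pts hℓ a θ W).map V = (alignmentKernel pts hℓ a θ W').map V := by
  simp only [alignmentKernel, PMF.map_bind, PMF.map_comp]
  congr 1
  funext Z
  congr 1
  funext γ
  refine Eq.trans ?_ (uniform_bind_add R₀ _)
  congr 1
  funext R
  rw [← PMF.bind_pure_comp, ← PMF.bind_pure_comp]
  refine Eq.trans ?_ (uniform_bind_add (M₀ Z R) _)
  congr 1
  funext M
  exact congrArg PMF.pure (h R M Z γ)

/-- Mask and interference lie in the same polynomial space, so masking keeps the answers in the code
and shifts only the part without desired symbols. -/
lemma honestAnswer_alignmentOutcome (θ : Fin K) (W : Fin K → Fin ℓ → F)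
    (R : Fin ℓ → Fin K → degreeLT F B) (M : degreeLT F (B + 1)) (Z : Fin ℓ → Fin K → F)
    (n : Fin N) :
    (alignmentScheme pts B K hℓ).honestAnswer n (alignmentOutcome pts hℓ θ W R M Z) =
      label (codeword pts (W θ) (interference pts W R Z θ + M) n) := by
  change label (∑ j, ∑ k, shares pts W R n j k * queries pts θ Z n j k + masks pts M n) = _
  rw [sum_shares_mul_queries, codeword, codeword, masks, eval_add, add_assoc]

lemma alignmentScheme_correct (hN : ℓ + B + 1 + 2 * B ≤ N) {D : Finset (Fin N)}
    (hD : D.card ≤ B) (a : (alignmentScheme pts B K hℓ).Attack D) (θ : Fin K) {x}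
    (hx : x ∈ ((alignmentScheme pts B K hℓ).attackLaw a θ).support) :
    (alignmentScheme pts B K hℓ).decode θ x.1.Q ((alignmentScheme pts B K hℓ).received a x) =
      x.1.W θ := by
  classical
  rw [attackLaw_eq, PMF.mem_support_bind_iff] at hx
  obtain ⟨W, -, hx⟩ := hx
  obtain ⟨R, M, Z, γ, rfl⟩ := exists_of_mem_support_alignmentKernel pts hℓ a θ W hx
  set r := (alignmentScheme pts B K hℓ).received a (alignmentOutcome pts hℓ θ W R M Z, γ)
  have hr : ∀ n, n ∉ D → r n = label (codeword pts (W θ) (interference pts W R Z θ + M) n) := by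
    intro n hn
    rw [← honestAnswer_alignmentOutcome]
    exact dif_neg hn
  have hP : interference pts W R Z θ + M ∈ degreeLT F (B + 1) :=
    add_mem (interference_mem pts W R Z θ) M.2
  have hex : ∃ w, IsNear pts B r w := ⟨W θ, _, hP, D, hD, hr⟩
  change (if h : ∃ w, IsNear pts B r w then h.choose else 0) = W θ
  rw [dif_pos hex]
  obtain ⟨P', hP', D', hD', hr'⟩ := hex.choose_spec
  refine codeword_unique pts hN hP' hP hD' hD fun n hn hn' => label_injective ?_
  rw [← hr' n hn, hr n hn']

lemma alignmentScheme_isValid [NeZero K] (hN : ℓ + B + 1 + 2 * B ≤ N) :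
    (alignmentScheme pts B K hℓ).IsValid B where
  storage_secure D hD := by
    set s := alignmentScheme pts B K hℓ
    have h : mutualInfo s.law (fun o => fun m : D => o.S m) (fun o => o.W) =
        mutualInfo s.storageLaw (fun x => fun m : D => x.2 m) Prod.fst := by
      rw [← s.law_map_storage, mutualInfo_map]
      rfl
    rw [h]
    refine mutualInfo_eq_zero_of_forall_eq _ _ _ (fun W x hx => ?_) fun W W' => ?_
    · obtain ⟨S, -, rfl⟩ := (PMF.mem_support_map_iff _ _ _).1 hx
      rfl
    · rw [PMF.map_comp, PMF.map_comp]
      exact shares_map_restrict_eq pts W W' D hD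
  no_leak D hD a θ := by
    have := a.finiteΓ
    rw [attackLaw_eq]
    refine mutualInfo_eq_zero_of_forall_eq _ _ _ (fun W x hx => ?_) fun W W' => ?_
    · obtain ⟨R, M, Z, γ, rfl⟩ := exists_of_mem_support_alignmentKernel pts hℓ a θ W hx
      rfl
    · obtain ⟨R₀, hR₀⟩ := exists_shares_eq pts W W' D hD
      -- Byzantine answers see the messages only through the storage of D, which the shift `R₀`
      -- preserves; the mask stays put.
      refine alignmentKernel_map_eq pts hℓ a θ W W' _ R₀ (fun _ _ => 0) fun R M Z γ => ?_
      funext n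
      rw [add_zero]
      simp only [Scheme.received, dif_pos n.2, alignmentOutcome]
      congr 1
      funext m
      exact (hR₀ R m m.2).symm
  user_private n := by
    refine mutualInfo_eq_zero_of_forall_eq _ _ _ (fun θ o ho => ?_) fun θ θ' => ?_
    · simp only [Scheme.lawGiven, PMF.mem_support_bind_iff, PMF.mem_support_pure_iff] at ho
      obtain ⟨W, -, S, -, Z, -, Q, -, rfl⟩ := ho
      rfl
    · simp only [Scheme.lawGiven, PMF.map_bind, PMF.pure_map, PMF.bind_const]
      exact queries_map_eq pts n θ θ'
  correct D hD a θ x hx := alignmentScheme_correct pts hℓ hN hD a θ hx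
  symmetric_private D hD a θ := by
    classical
    have := a.finiteΓ
    rw [mutualInfo_comm, attackLaw_eq]
    refine mutualInfo_eq_zero_of_equiv (ξ := {k : Fin K // k ≠ θ} → Fin ℓ → F)
      (M := Fin K → Fin ℓ → F) _ _ _ (fun W k => W k) (fun W x hx => ?_) (fun y y' =>
      Equiv.addRight fun k => if h : k ≠ θ then y' ⟨k, h⟩ - y ⟨k, h⟩ else 0)
      (fun y y' W => ?_) fun y y' W => ?_
    · obtain ⟨R, M, Z, γ, rfl⟩ := exists_of_mem_support_alignmentKernel pts hℓ a θ W hx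
      rfl
    · simp only [funext_iff, Equiv.coe_addRight, Pi.add_apply]
      refine forall_congr' fun k => forall_congr' fun j => ?_
      rw [dif_pos k.2, Pi.sub_apply]
      constructor
      · intro h
        linear_combination h
      · intro h
        linear_combination h
    · set W' := Equiv.addRight (fun k => if h : k ≠ θ then y' ⟨k, h⟩ - y ⟨k, h⟩ else 0) W with hW'
      have hθ : W' θ = W θ := by
        simp [hW']
      obtain ⟨R₀, hR₀⟩ := exists_shares_eq pts W W' D hD
      symm
      -- The shift `R₀` preserves the storage of D, and the mask shift cancels the change of
      -- interference, so honest answers are unchanged.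
      refine alignmentKernel_map_eq pts hℓ a θ W W' _ R₀ (fun Z R =>
        ⟨interference pts W R Z θ - interference pts W' (R + R₀) Z θ,
          sub_mem (interference_mem pts W R Z θ) (interference_mem pts W' (R + R₀) Z θ)⟩)
        fun R M Z γ => ?_
      refine Prod.ext (funext fun n => ?_) rfl
      simp only [Scheme.received]
      split_ifs with hn
      -- The Byzantine servers know their masks, so these must not move. On D the shares agree and
      -- so does the desired message, hence the interference agrees there and the mask shift
      -- vanishes.
      · have hmask : ∀ m ∈ D, (interference pts W R Z θ).eval (pts (.inl m)) =
            (interference pts W' (R + R₀) Z θ).eval (pts (.inl m)) := by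
          intro m hm
          have h1 := sum_shares_mul_queries pts W R Z θ m
          have h2 := sum_shares_mul_queries pts W' (R + R₀) Z θ m
          rw [hR₀ R m hm, h1, hθ] at h2
          exact add_left_cancel h2
        simp only [alignmentOutcome]
        congr 1
        · funext m
          exact (hR₀ R m m.2).symm
        · funext m
          simp only [masks, Submodule.coe_add, eval_add, eval_sub, hmask m m.2]
          ring
      · rw [honestAnswer_alignmentOutcome, honestAnswer_alignmentOutcome, hθ, Submodule.coe_add]
        congr 2
        ring

/-- Each answer is one field element, of entropy at most one symbol, and ℓ symbols are retrieved. -/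
lemma le_rate_alignmentScheme [NeZero K] :
    ENNReal.ofReal (ℓ / N) ≤ (alignmentScheme pts B K hℓ).rate := by
  classical
  set s := alignmentScheme pts B K hℓ with hs
  have hlog : 0 < Real.log (Fintype.card s.Sym) :=
    Real.log_pos (by exact_mod_cast Fintype.one_lt_card)
  have h : ∀ n, entropy s.law (s.honestAnswer n) ≤ Real.log (Fintype.card s.Sym) := by
    intro n
    have h1 := entropy_le_log_card s.law (X := s.honestAnswer n)
      (s := Finset.univ.image (label : F → ℕ))
      (fun o => Finset.mem_image_of_mem _ (Finset.mem_univ _))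
    rw [Finset.card_image_of_injective _ label_injective, Finset.card_univ] at h1
    exact h1
  have hE : (∑ n, entropy s.law (s.honestAnswer n)) / Real.log (Fintype.card s.Sym) ≤ N := by
    rw [div_le_iff₀ hlog]
    refine (Finset.sum_le_sum fun n _ => h n).trans_eq ?_
    simp
  rcases Nat.eq_zero_or_pos N with h0 | h0
  · simp [h0]
  rw [ENNReal.ofReal_div_of_pos (by exact_mod_cast h0), ENNReal.ofReal_natCast, Scheme.rate]
  exact ENNReal.div_le_div_left (ENNReal.ofReal_le_ofReal hE) _

end CrossSubspaceAlignment


/-! ### Lower bound on the capacity and the limit -/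

lemma le_capacity {N B K : ℕ} [NeZero K] (hN : 3 * B + 1 ≤ N) :
    ENNReal.ofReal (1 - (3 * (B : ℝ) + 1) / N) ≤ capacity N B K := by
  -- For N = 3B + 1 the scheme would have message length 0, but the bound is then 0.
  rcases Nat.eq_zero_or_pos (N - (3 * B + 1)) with h0 | hℓ
  · have h : (N : ℝ) = 3 * B + 1 := by exact_mod_cast (by omega : N = 3 * B + 1)
    rw [h, div_self (by positivity)]
    simp
  set ℓ := N - (3 * B + 1) with hℓ_def
  obtain ⟨p, hp, hprime⟩ := Nat.exists_infinite_primes (N + ℓ)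
  have : Fact p.Prime := ⟨hprime⟩
  obtain ⟨pts⟩ := Function.Embedding.nonempty_of_card_le (α := Fin N ⊕ Fin ℓ) (β := ZMod p)
    (by simpa [ZMod.card] using hp)
  refine le_trans ?_ (le_iSup₂_of_le (alignmentScheme pts B K hℓ)
    (alignmentScheme_isValid pts hℓ (by omega)) le_rfl)
  refine le_of_eq_of_le ?_ (le_rate_alignmentScheme pts hℓ)
  congr 1
  have hN0 : (0 : ℝ) < N := by exact_mod_cast (by omega : 0 < N)
  rw [hℓ_def, Nat.cast_sub hN]
  push_cast
  field_simp

/-- The partial sums of the geometric series with ratio `1 / M` have limit `M / (M - 1)`. -/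
lemma tendsto_div_geom_sum {M : ℕ} (hM : 0 < M) :
    Filter.Tendsto (fun K : ℕ => (M : ℝ) / ∑ i ∈ Finset.range (K + 1), ((M : ℝ)⁻¹) ^ i)
      Filter.atTop (nhds (M - 1)) := by
  have hM0 : (0 : ℝ) < M := by exact_mod_cast hM
  rcases (show 1 ≤ M from hM).eq_or_lt with rfl | h1
  -- For M = 1 the series diverges: its partial sums are K + 1, and the quotient tends to 0 = M - 1.
  · simp only [Nat.cast_one, inv_one, one_pow, Finset.sum_const, Finset.card_range, nsmul_eq_mul,
      mul_one, sub_self]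
    simpa using tendsto_one_div_add_atTop_nhds_zero_nat (𝕜 := ℝ)
  · have hlt : (M : ℝ)⁻¹ < 1 := inv_lt_one_of_one_lt₀ (by exact_mod_cast h1)
    have hgeom := (hasSum_geometric_of_lt_one (by positivity) hlt).tendsto_sum_nat
    have h2 := (hgeom.comp (Filter.tendsto_add_atTop_nat 1)).inv₀
      (by simpa using (sub_pos.2 hlt).ne')
    have h3 := h2.const_mul (M : ℝ)
    rw [inv_inv, mul_sub, mul_one, mul_inv_cancel₀ hM0.ne'] at h3
    simpa [div_eq_mul_inv] using h3

end ByzantineSPIR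

end

theorem lemma1 (N B : ℕ) (hN : 3 * B + 1 ≤ N) :
    Filter.Tendsto (fun K : ℕ => ByzantineSPIR.capacity N B (K + 1)) Filter.atTop
      (nhds (ENNReal.ofReal (1 - (3 * (B : ℝ) + 1) / (N : ℝ)))) := by
  have hN0 : (0 : ℝ) < N := by exact_mod_cast (by omega : 0 < N)
  have hlim := (ByzantineSPIR.tendsto_div_geom_sum (M := N - 3 * B) (by omega)).div_const (N : ℝ)
  have heq : (((N - 3 * B : ℕ) : ℝ) - 1) / N = 1 - (3 * (B : ℝ) + 1) / N := by
    rw [Nat.cast_sub (by omega)]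
    push_cast
    field_simp
    ring
  rw [heq] at hlim
  refine tendsto_of_tendsto_of_tendsto_of_le_of_le tendsto_const_nhds
    (ENNReal.tendsto_ofReal hlim) (fun K => ByzantineSPIR.le_capacity hN) fun K => ?_
  refine iSup₂_le fun s hv => (s.rate_le hv hN).trans_eq ?_
  rw [div_right_comm]
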